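/- **Conventions.** A partition is a finite weakly decreasing sequence $\lambda=(\lambda_1,\dots,\lambda_l)$ of positive integers, with length $\ell(\lambda)=l$ and size $|\lambda|=\sum_i\lambda_i$ (the empty partition is allowed). It is strict if its parts are pairwise distinct and odd if all its parts are odd. $m_r(\rho)$ is the number of parts of $\rho$ equal to $r$, $z_\rho=\prod_{r\ge1}r^{m_r(\rho)}m_r(\rho)!$, and $x^{\downarrow k}=x(x-1)\cdots(x-k+1)$ with $x^{\downarrow 0}=1$. Let $\mathcal{SP}_n$ be the set of strict partitions of $n$, and $\mathcal{SP}=\bigcup_{n\ge 0}\mathcal{SP}_n$. For $\lambda\in\mathcal{SP}$ let $S(\lambda)=\{(i,j): 1\le i\le\ell(\lambda),\ i\le j\le\lambda_i+i-1\}$, and let $g^\lambda$ be the number of sequences $\emptyset=\lambda^{(0)},\lambda^{(1)},\dots,\lambda^{(|\lambda|)}=\lambda$ of strict partitions such that each $S(\lambda^{(i)})$ is obtained from $S(\lambda^{(i-1)})$ by adding exactly one box. For a function $\varphi$ on $\mathcal{SP}$, its average under the shifted Plancherel measure is $$\mathbb{E}_n[\varphi]=\sum_{\lambda\in\mathcal{SP}_n}\frac{2^{\,n-\ell(\lambda)}(g^\lambda)^2}{n!}\,\varphi(\lambda).$$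 Let $p_r=x_1^r+x_2^r+\cdots$, $p_\rho=p_{\rho_1}p_{\rho_2}\cdots$, and let $\Gamma$ be the $\mathbb{Q}$-algebra of symmetric functions generated by $p_1,p_3,p_5,\dots$. For $f\in\Gamma$ and $\lambda\in\mathcal{SP}$ write $f(\lambda)=f(\lambda_1,\dots,\lambda_{\ell(\lambda)},0,0,\dots)$. For $\lambda\in\mathcal{SP}$ of length $l$, the Schur $P$-function $P_\lambda\in\Gamma$ and the factorial Schur $P$-function $P^*_\lambda\in\Gamma$ are given in $N\ge l$ variables by $$\frac1{(N-l)!}\sum_{\omega\in S_N}\omega\Big(\prod_{i=1}^{l}u_{\lambda_i}(x_i)\prod_{1\le i\le l,\ i<j\le N}\frac{x_i+x_j}{x_i-x_j}\Big),$$ with $u_k(x)=x^k$ for $P_\lambda$ and $u_k(x)=x^{\downarrow k}$ for $P^*_\lambda$, and by $0$ in $N<l$ variables; here $S_N$ permutes $x_1,\dots,x_N$. The families $(P_\lambda)_{\lambda\in\mathcal{SP}}$ and $(P^*_\lambda)_{\lambda\in\mathcal{SP}}$ are linear bases of $\Gamma$. Let $\Psi:\Gamma\to\Gamma$ be the linear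 isomorphism with $\Psi(P_\lambda)=P^*_\lambda$ for all $\lambda\in\mathcal{SP}$, and for an odd partition $\rho$ put $\mathfrak{p}_\rho=\Psi(p_\rho)$. **Theorem.** Let $\rho$ and $\sigma$ be odd partitions with $m_1(\rho)=m_1(\sigma)=0$. Then for every integer $n\ge0$, $$\mathbb{E}_n[\mathfrak{p}_\rho\,\mathfrak{p}_\sigma]=\delta_{\rho,\sigma}\,2^{|\rho|-\ell(\rho)}\,z_\rho\,n^{\downarrow|\rho|}.$$ -/

import Mathlib

/-- A partition: a finite weakly decreasing sequence of positive integers. -/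
@[ext]
structure IntPartition where
  parts : List ℕ
  sorted : parts.Pairwise (· ≥ ·)
  pos : ∀ a ∈ parts, 0 < a

namespace IntPartition

noncomputable instance : DecidableEq IntPartition := Classical.decEq _

/-- The length `ℓ(ρ)`. -/
def length (ρ : IntPartition) : ℕ := ρ.parts.length

/-- The size `|ρ|`. -/
def size (ρ : IntPartition) : ℕ := ρ.parts.sum

/-- The `i`-th part for `i = 1, 2, …`; it is `0` beyond the length. -/
def part (ρ : IntPartition) (i : ℕ) : ℕ := ρ.parts.getD (i - 1) 0

/-- The multiplicity `m_r(ρ)`. -/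
def mult (ρ : IntPartition) (r : ℕ) : ℕ := ρ.parts.count r

/-- All parts are pairwise distinct. -/
def IsStrict (ρ : IntPartition) : Prop := ρ.parts.Nodup

/-- All parts are odd. -/
def IsOdd (ρ : IntPartition) : Prop := ∀ a ∈ ρ.parts, Odd a

/-- `z_ρ = ∏_{r ≥ 1} r ^ m_r(ρ) * m_r(ρ)!`; only the `r` occurring in `ρ` contribute. -/
def z (ρ : IntPartition) : ℕ :=
  ∏ r ∈ ρ.parts.toFinset, r ^ ρ.mult r * (ρ.mult r).factorial

/-- The shifted diagram `{(i, j) : 1 ≤ i ≤ ℓ(ρ), i ≤ j ≤ ρ_i + i - 1}`. -/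
def shiftedDiagram (ρ : IntPartition) : Set (ℕ × ℕ) :=
  {b | 1 ≤ b.1 ∧ b.1 ≤ ρ.length ∧ b.1 ≤ b.2 ∧ b.2 < ρ.part b.1 + b.1}

end IntPartition

/-- The set of strict partitions. -/
abbrev StrictPartition : Type := {lam : IntPartition // lam.IsStrict}

namespace StrictPartition

/-- The empty partition. -/
def empty : StrictPartition := ⟨⟨[], List.Pairwise.nil, by simp⟩, List.nodup_nil⟩

/-- The shifted diagram of `lam` arises from that of `mu` by adding exactly one box. -/
def AddsBox (mu lam : StrictPartition) : Prop :=
  ∃ b, b ∉ mu.1.shiftedDiagram ∧ lam.1.shiftedDiagram = insert b mu.1.shiftedDiagram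

/-- The number `g^lam` of standard tableaux of shape `S(lam)`: sequences of strict partitions
from the empty one to `lam`, each obtained from the preceding one by adding exactly one box. -/
noncomputable def g (lam : StrictPartition) : ℕ :=
  Set.ncard {T : Fin (lam.1.size + 1) → StrictPartition |
    T 0 = empty ∧ T (Fin.last _) = lam ∧
      ∀ i : Fin lam.1.size, AddsBox (T i.castSucc) (T i.succ)}

theorem finite_size_eq (n : ℕ) : {lam : StrictPartition | lam.1.size = n}.Finite := by
  have hfin : Set.Finite ((fun s : Finset ℕ => s.sort (· ≥ ·)) ''
      (↑(Finset.range (n + 1)).powerset : Set (Finset ℕ))) :=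
    (Finset.finite_toSet _).image _
  refine Set.Finite.of_finite_image (f := fun lam : StrictPartition => lam.1.parts)
    (hfin.subset ?_) ?_
  · rintro _ ⟨lam, hlam, rfl⟩
    refine ⟨lam.1.parts.toFinset, ?_, ?_⟩
    · simp only [Finset.coe_powerset, Set.mem_preimage, Set.mem_powerset_iff]
      intro a ha
      have ha' : a ∈ lam.1.parts := by simpa using ha
      have h1 : a ≤ lam.1.parts.sum := List.le_sum_of_mem ha'
      have h2 : lam.1.parts.sum = n := hlam
      simp only [Finset.coe_range, Set.mem_Iio]
      omega
    · exact (List.toFinset_sort (· ≥ ·) lam.2).2 lam.1.sorted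
  · intro a _ b _ hab
    exact Subtype.ext (IntPartition.ext hab)

/-- The finite set `SP_n` of strict partitions of `n`. -/
noncomputable def ofSize (n : ℕ) : Finset StrictPartition := (finite_size_eq n).toFinset

/-- The shifted Plancherel measure `2 ^ (n - ℓ(lam)) * (g^lam)² / n!` on `SP_n`
(here `ℓ(lam) ≤ n`, so the subtraction is the usual one). -/
noncomputable def plancherel (n : ℕ) (lam : StrictPartition) : ℚ :=
  2 ^ (n - lam.1.length) * (lam.g : ℚ) ^ 2 / n.factorial

/-- The shifted Plancherel average `𝔼_n[φ]`. -/
noncomputable def average (n : ℕ) (φ : StrictPartition → ℚ) : ℚ :=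
  ∑ lam ∈ ofSize n, plancherel n lam * φ lam

end StrictPartition

/-- Sequences `(F_N)` with `F_N` a polynomial in `N` variables. Symmetric functions are such
sequences (with each `F_N` symmetric and `F_{N+1}(x_1, …, x_N, 0) = F_N(x_1, …, x_N)`), with
termwise operations. -/
abbrev PolySeq : Type := (N : ℕ) → MvPolynomial (Fin N) ℚ

namespace PolySeq

/-- The value `f(lam_1, …, lam_l, 0, 0, …)` at a strict partition of length `l`; by stability it
may be computed in `l` variables. -/
noncomputable def value (f : PolySeq) (lam : StrictPartition) : ℚ :=
  MvPolynomial.eval (fun i : Fin lam.1.length => (lam.1.part (i + 1) : ℚ)) (f lam.1.length)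

/-- The power sum `p_r = x_1 ^ r + x_2 ^ r + ⋯`. -/
noncomputable def powerSum (r : ℕ) : PolySeq := fun N => MvPolynomial.psum (Fin N) ℚ r

/-- `p_ρ = p_{ρ_1} p_{ρ_2} ⋯`. -/
noncomputable def powerSumPartition (ρ : IntPartition) : PolySeq := (ρ.parts.map powerSum).prod

/-- Rational functions in `x_1, …, x_N`. -/
abbrev RatFun (N : ℕ) : Type := FractionRing (MvPolynomial (Fin N) ℚ)

/-- The variable `x_i` as a rational function. -/
noncomputable def ratVar {N : ℕ} (i : Fin N) : RatFun N :=
  algebraMap (MvPolynomial (Fin N) ℚ) (RatFun N) (MvPolynomial.X i)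

/-- With `l = ℓ(lam) ≤ N` and a notion `pw x k` of `k`-th power of `x`, the symmetrization
`1/(N-l)! * ∑_{ω ∈ S_N} ω (∏_{i ≤ l} pw x_i lam_i * ∏_{i ≤ l, i < j ≤ N} (x_i + x_j)/(x_i - x_j))`,
and `0` if `l > N`. The indices `i : Fin N` count from `0`. -/
noncomputable def symmetrization (lam : StrictPartition) (N : ℕ)
    (pw : RatFun N → ℕ → RatFun N) : RatFun N :=
  if lam.1.length ≤ N then
    ((N - lam.1.length).factorial : RatFun N)⁻¹ * ∑ ω : Equiv.Perm (Fin N),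
      ∏ i ∈ Finset.univ.filter (fun i : Fin N => (i : ℕ) < lam.1.length),
        (pw (ratVar (ω i)) (lam.1.part (i + 1)) *
          ∏ j ∈ Finset.Ioi i,
            (ratVar (ω i) + ratVar (ω j)) / (ratVar (ω i) - ratVar (ω j)))
  else 0

open Classical in
/-- A rational function that is a polynomial, as a polynomial (all others are sent to `0`). -/
noncomputable def toPolynomial {N : ℕ} (r : RatFun N) : MvPolynomial (Fin N) ℚ :=
  if h : ∃ f, algebraMap (MvPolynomial (Fin N) ℚ) (RatFun N) f = r then h.choose else 0

/-- The Schur `P`-function `P_lam`. -/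
noncomputable def schurP (lam : StrictPartition) : PolySeq :=
  fun N => toPolynomial (symmetrization lam N fun x k => x ^ k)

/-- The factorial Schur `P`-function `P*_lam`, with `x (x - 1) ⋯ (x - k + 1)` in place of
`x ^ k`. -/
noncomputable def factorialSchurP (lam : StrictPartition) : PolySeq :=
  fun N => toPolynomial (symmetrization lam N fun x k => ∏ m ∈ Finset.range k, (x - m))

open Classical in
/-- The coefficients of `f` in its expansion in Schur `P`-functions. For `f` in the algebra
generated by the odd power sums, of which the Schur `P`-functions are a basis, they exist and are
unique. -/
noncomputable def schurPCoeff (f : PolySeq) : StrictPartition →₀ ℚ :=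
  if h : ∃ c : StrictPartition →₀ ℚ, f = c.sum fun lam a => a • schurP lam then h.choose else 0

/-- The linear map `Ψ` determined by `Ψ(P_lam) = P*_lam`, on the algebra generated by the odd power
sums. -/
noncomputable def psi (f : PolySeq) : PolySeq :=
  (schurPCoeff f).sum fun lam a => a • factorialSchurP lam

/-- The supersymmetric function `𝔭_ρ = Ψ(p_ρ)`, for an odd partition `ρ`. -/
noncomputable def frakP (ρ : IntPartition) : PolySeq := psi (powerSumPartition ρ)

end PolySeq

/-! Give Γ the scalar product in which the P_λ are orthogonal with ⟨P_λ, P_λ⟩ = 2^{-ℓ(λ)}. The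
averages in the theorem are scalar products in disguise, for two reasons.

Values. The relation x · x^{↓k} = x^{↓(k+1)} + k x^{↓k} yields p_1 P*_μ = |μ| P*_μ + ∑ P*_ν, the sum
over ν obtained from μ by adding a box (`evalAt_mulP_one`). Also P*_μ(λ) = 0 if |μ| ≥ |λ| and μ ≠ λ
(`evalAt_vec_eq_zero`). Evaluating at λ of size n and iterating, (n-|ρ|)! 𝔭_ρ(λ) is the coefficient
of P_λ in p_1^{n-|ρ|} p_ρ times P*_λ(λ) (`evalAt_powerVec`); the empty ρ gives g^λ P*_λ(λ) = n!
(`g_mul_selfValue`). In the average the factors g^λ and P*_λ(λ) therefore cancel, and what is left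
is n! 2^n / ((n-|ρ|)! (n-|σ|)!) times ⟨p_1^{n-|ρ|} p_ρ, p_1^{n-|σ|} p_σ⟩
(`average_frakP_mul_frakP`).

Orthogonality. For odd partitions ⟨p_ρ, p_σ⟩ = δ z_ρ 2^{-ℓ(ρ)} (`form_powerVec`). Here Γ is replaced
by a Fock space on which multiplication by p_r is the operator `mulP r`, formally ∑_j (-1)^j φ_{j+r}
φ_{-j} in the neutral fermions φ_j. An operator that commutes with all φ_j is a scalar
(`eq_smul_one_of_commute`), whence the Heisenberg relation [p_r^*, p_s] = δ_{r,s} r/2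
(`mulPAdj_mulP`). Since ρ and σ have no part 1, padding by ones keeps different partitions different
and multiplies z_ρ by (n-|ρ|)!.

The bridge is `symMap_mulP`: under symmetrization `mulP r` becomes multiplication by p_r. It is an
induction over creation operators that starts from the expansion of p_r itself
(`sum_pow_eq_symMap`), a partial fraction identity. Finally, the symmetrizations are polynomials
(`exists_represents_symSum`) and the P_λ are independent (`schurMap_injective`), so Ψ is the
intended map. -/

/-! ### Fermionic Fock space. -/

/-- The sign picked up by moving `k` past the larger elements of `S`. -/
def fockSign (k : ℕ) (S : Finset ℕ) : ℚ := (-1) ^ (S.filter (k < ·)).card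

theorem fockSign_mul_self (k : ℕ) (S : Finset ℕ) : fockSign k S * fockSign k S = 1 := by
  unfold fockSign
  rw [← mul_pow]; norm_num

theorem fockSign_insert {k : ℕ} {S : Finset ℕ} (hk : k ∉ S) (j : ℕ) :
    fockSign j (insert k S) = (if j < k then -1 else 1) * fockSign j S := by
  unfold fockSign
  rw [Finset.filter_insert]
  split_ifs with h
  · rw [Finset.card_insert_of_notMem (by simp [hk]), pow_succ]; ring
  · simp

theorem fockSign_erase {k : ℕ} {S : Finset ℕ} (hk : k ∈ S) (j : ℕ) :
    fockSign j (S.erase k) = (if j < k then -1 else 1) * fockSign j S := by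
  conv_rhs => rw [← Finset.insert_erase hk, fockSign_insert (Finset.notMem_erase k S)]
  split_ifs <;> ring

/-- The Fock space with basis the finite sets of natural numbers. The set `S` stands for the
strict partition with parts `k + 1`, `k ∈ S`. -/
def Fock : Type := Finset ℕ →₀ ℚ

noncomputable instance : AddCommGroup Fock := inferInstanceAs (AddCommGroup (Finset ℕ →₀ ℚ))

noncomputable instance : Module ℚ Fock := inferInstanceAs (Module ℚ (Finset ℕ →₀ ℚ))

namespace Fock

/-- The basis of the Fock space. -/
noncomputable def basis : Module.Basis (Finset ℕ) ℚ Fock :=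
  ⟨LinearEquiv.refl ℚ (Finset ℕ →₀ ℚ)⟩

/-- The basis vector of a finite set. -/
noncomputable def vec (S : Finset ℕ) : Fock := basis S

/-- The linear map with given values on the basis. -/
noncomputable def lift {W : Type*} [AddCommMonoid W] [Module ℚ W] (f : Finset ℕ → W) :
    Fock →ₗ[ℚ] W :=
  basis.constr ℚ f

theorem lift_vec {W : Type*} [AddCommMonoid W] [Module ℚ W] (f : Finset ℕ → W) (S : Finset ℕ) :
    lift f (vec S) = f S :=
  basis.constr_basis ℚ f S

/-- The coordinates of a vector. -/
noncomputable def coeff (S : Finset ℕ) : Fock →ₗ[ℚ] ℚ := basis.coord S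

theorem coeff_vec (S T : Finset ℕ) : coeff S (vec T) = if T = S then 1 else 0 := by
  rw [coeff, vec, Module.Basis.coord_apply, Module.Basis.repr_self, Finsupp.single_apply]

theorem ext_coeff {x y : Fock} (h : ∀ S, coeff S x = coeff S y) : x = y :=
  basis.ext_elem h

theorem hom_ext {W : Type*} [AddCommMonoid W] [Module ℚ W] {A B : Fock →ₗ[ℚ] W}
    (h : ∀ S, A (vec S) = B (vec S)) : A = B :=
  basis.ext h

/-- The creation operator. -/
noncomputable def create (k : ℕ) : Module.End ℚ Fock :=
  lift fun S => if k ∈ S then 0 else fockSign k S • vec (insert k S)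

/-- The annihilation operator. -/
noncomputable def annih (k : ℕ) : Module.End ℚ Fock :=
  lift fun S => if k ∈ S then fockSign k S • vec (S.erase k) else 0

/-- The diagonal operator with eigenvalues `f S`. -/
noncomputable def diag (f : Finset ℕ → ℚ) : Module.End ℚ Fock :=
  lift fun S => f S • vec S

/-- The parity operator. -/
noncomputable def parity : Module.End ℚ Fock := diag fun S => (-1) ^ S.card

theorem create_vec (k : ℕ) (S : Finset ℕ) :
    create k (vec S) = if k ∈ S then 0 else fockSign k S • vec (insert k S) := by
  exact lift_vec _ _

theorem annih_vec (k : ℕ) (S : Finset ℕ) :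
    annih k (vec S) = if k ∈ S then fockSign k S • vec (S.erase k) else 0 := by
  exact lift_vec _ _

theorem diag_vec (f : Finset ℕ → ℚ) (S : Finset ℕ) : diag f (vec S) = f S • vec S := by
  exact lift_vec _ _

theorem parity_vec (S : Finset ℕ) : parity (vec S) = (-1 : ℚ) ^ S.card • vec S := diag_vec _ _

theorem create_anticomm (j k : ℕ) : create j * create k + create k * create j = 0 := by
  refine hom_ext fun S => ?_
  simp only [LinearMap.add_apply, Module.End.mul_apply, create_vec, LinearMap.zero_apply]
  by_cases hj : j ∈ S <;> by_cases hk : k ∈ S <;>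
    simp only [hj, hk, if_true, if_false, map_zero, map_smul, create_vec, Finset.mem_insert, or_true,
      smul_zero, add_zero]
  rcases lt_trichotomy j k with h | h | h
  · simp only [h.ne, h.ne', or_false, if_false, fockSign_insert hj, fockSign_insert hk, h,
      h.le.not_gt, if_true, smul_smul, Finset.insert_comm j k]
    rw [← add_smul]
    ring_nf
    simp
  · simp [h]
  · simp only [h.ne, h.ne', or_false, if_false, fockSign_insert hj, fockSign_insert hk, h,
      h.le.not_gt, if_true, smul_smul, Finset.insert_comm j k]
    rw [← add_smul]
    ring_nf
    simp

theorem annih_create_of_ne {j k : ℕ} (hjk : j ≠ k) :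
    annih j * create k + create k * annih j = 0 := by
  refine hom_ext fun S => ?_
  simp only [LinearMap.add_apply, Module.End.mul_apply, create_vec, annih_vec, LinearMap.zero_apply]
  by_cases hj : j ∈ S <;> by_cases hk : k ∈ S <;>
    simp only [hj, hk, if_true, if_false, map_zero, map_smul, create_vec, annih_vec,
      Finset.mem_insert, Finset.mem_erase, or_true, hjk, hjk.symm, ne_eq, not_false_eq_true,
      and_true, and_false, or_false, 
      smul_zero, add_zero]
  have hkj : k ∉ S.erase j := fun h => hk (Finset.mem_of_mem_erase h)
  rw [Finset.erase_insert_of_ne hjk.symm]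
  rw [fockSign_insert hk, fockSign_erase hj, smul_smul, smul_smul, ← add_smul]
  rcases lt_or_gt_of_ne hjk with h | h
  · simp only [h, h.le.not_gt, if_true, if_false]
    ring_nf
    simp
  · simp only [h, h.le.not_gt, if_true, if_false]
    ring_nf
    simp

theorem annih_create_self (k : ℕ) : annih k * create k + create k * annih k = 1 := by
  refine hom_ext fun S => ?_
  simp only [LinearMap.add_apply, Module.End.mul_apply, create_vec, annih_vec,
    Module.End.one_apply]
  by_cases hk : k ∈ S
  · simp only [hk, if_true, map_zero, map_smul, create_vec, Finset.mem_erase, ne_eq,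
      not_true_eq_false, false_and, if_false, fockSign_erase hk, lt_irrefl, one_mul, smul_smul,
      fockSign_mul_self, Finset.insert_erase hk, one_smul, zero_add]
  · simp only [hk, if_false, map_zero, map_smul, annih_vec, Finset.mem_insert, true_or, if_true,
      fockSign_insert hk, lt_irrefl, one_mul, smul_smul,
      fockSign_mul_self, Finset.erase_insert hk, one_smul, add_zero]

theorem diag_create (f : Finset ℕ → ℚ) (k : ℕ) (S : Finset ℕ) :
    diag f (create k (vec S)) = f (insert k S) • create k (vec S) := by
  rw [create_vec]
  split_ifs
  · simp
  · rw [map_smul, diag_vec, smul_comm]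

theorem diag_annih (f : Finset ℕ → ℚ) (k : ℕ) (S : Finset ℕ) :
    diag f (annih k (vec S)) = f (S.erase k) • annih k (vec S) := by
  rw [annih_vec]
  split_ifs
  · rw [map_smul, diag_vec, smul_comm]
  · simp

theorem parity_create (k : ℕ) : parity * create k = -(create k * parity) := by
  refine hom_ext fun S => ?_
  simp only [Module.End.mul_apply, LinearMap.neg_apply, map_smul, parity, diag_vec,
    diag_create]
  rw [create_vec]
  split_ifs with h
  · simp
  · rw [Finset.card_insert_of_notMem h, pow_succ]; simp

theorem parity_annih (k : ℕ) : parity * annih k = -(annih k * parity) := by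
  refine hom_ext fun S => ?_
  simp only [Module.End.mul_apply, LinearMap.neg_apply, map_smul, parity, diag_vec,
    diag_annih]
  rw [annih_vec]
  split_ifs with h
  · rw [← Finset.card_erase_add_one h, pow_succ]; simp
  · simp

theorem parity_parity : parity * parity = 1 := by
  refine hom_ext fun S => ?_
  simp only [Module.End.mul_apply, parity_vec, map_smul, smul_smul, ← mul_pow,
    Module.End.one_apply]
  simp

/-- The diagonal operator adding up `c k` over the elements `k`. -/
noncomputable def weightOp (c : ℕ → ℚ) : Module.End ℚ Fock := diag fun S => ∑ k ∈ S, c k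

theorem weightOp_create (c : ℕ → ℚ) (k : ℕ) :
    weightOp c * create k = create k * weightOp c + c k • create k := by
  refine hom_ext fun S => ?_
  simp only [Module.End.mul_apply, weightOp, diag_vec, diag_create, LinearMap.add_apply,
    LinearMap.smul_apply, map_smul, ← add_smul]
  rw [create_vec]
  split_ifs with h
  · simp
  · rw [Finset.sum_insert h, add_comm]

/-- The derivation that raises each element by `r`. -/
noncomputable def shiftUp (r : ℕ) : Module.End ℚ Fock :=
  lift fun S => ∑ k ∈ S, create (k + r) (annih k (vec S))

/-- Terms with k outside `S` vanish. Any common finite range `T` may thus replace the formally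
infinite sum ∑_k `create (k + r) * annih k`, and commutators can be computed with finite sums. -/
theorem shiftUp_vec {S T : Finset ℕ} (h : S ⊆ T) (r : ℕ) :
    shiftUp r (vec S) = (∑ k ∈ T, create (k + r) * annih k) (vec S) := by
  have : shiftUp r (vec S) = ∑ k ∈ S, create (k + r) (annih k (vec S)) := by exact lift_vec _ _
  rw [this, LinearMap.sum_apply]
  refine Finset.sum_subset h fun k _ hk => ?_
  simp [annih_vec, hk]

theorem shiftUp_create_vec {S T : Finset ℕ} {j : ℕ} (h : S ⊆ T) (hj : j ∈ T) (r : ℕ) :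
    shiftUp r (create j (vec S)) = (∑ k ∈ T, create (k + r) * annih k) (create j (vec S)) := by
  rw [create_vec]
  split_ifs
  · simp
  · rw [map_smul, map_smul, shiftUp_vec (Finset.insert_subset hj h)]

theorem shiftUp_annih_vec {S T : Finset ℕ} {j : ℕ} (h : S ⊆ T) (r : ℕ) :
    shiftUp r (annih j (vec S)) = (∑ k ∈ T, create (k + r) * annih k) (annih j (vec S)) := by
  rw [annih_vec]
  split_ifs
  · rw [map_smul, map_smul, shiftUp_vec ((Finset.erase_subset _ _).trans h)]
  · simp

end Fock

/-! ### Scalar product and adjoint operators. -/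

namespace Fock

/-- The scalar product on the Fock space. -/
noncomputable def form : LinearMap.BilinForm ℚ Fock :=
  lift fun S => ((2 : ℚ)⁻¹ ^ S.card) • coeff S

theorem form_vec (S : Finset ℕ) (y : Fock) : form (vec S) y = 2⁻¹ ^ S.card * coeff S y := by
  simp [form, lift_vec]

theorem form_vec_vec (S T : Finset ℕ) :
    form (vec S) (vec T) = if S = T then 2⁻¹ ^ S.card else 0 := by
  rw [form_vec, coeff_vec]
  simp [eq_comm]

theorem form_ext {x y : Fock} (h : ∀ S, form (vec S) x = form (vec S) y) : x = y := by
  refine ext_coeff fun S => ?_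
  have := h S
  rw [form_vec, form_vec] at this
  exact mul_left_cancel₀ (by positivity) this

theorem form_comm (x y : Fock) : form x y = form y x := by
  have : form = LinearMap.flip form := by
    refine hom_ext fun S => hom_ext fun T => ?_
    rw [LinearMap.flip_apply, form_vec_vec, form_vec_vec]
    by_cases h : S = T
    · simp [h]
    · simp [h, Ne.symm h]
  conv_lhs => rw [this]
  rfl

/-- `A'` is adjoint to `A`. -/
def IsAdjoint (A A' : Module.End ℚ Fock) : Prop := ∀ x y, form (A x) y = form x (A' y)

theorem adjoint_of_vec {A A' : Module.End ℚ Fock}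
    (h : ∀ S T, form (A (vec S)) (vec T) = form (vec S) (A' (vec T))) : IsAdjoint A A' := by
  intro x y
  have : LinearMap.comp form A = LinearMap.compl₂ form A' :=
    hom_ext fun S => hom_ext fun T => by simpa using h S T
  simpa using LinearMap.congr_fun (LinearMap.congr_fun this x) y

theorem IsAdjoint.symm {A A' : Module.End ℚ Fock} (h : IsAdjoint A A') : IsAdjoint A' A :=
  fun x y => by rw [form_comm, ← h, form_comm]

theorem IsAdjoint.add {A A' C C' : Module.End ℚ Fock} (h : IsAdjoint A A') (h' : IsAdjoint C C') :
    IsAdjoint (A + C) (A' + C') := fun x y => by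
  simp [h x y, h' x y]

theorem IsAdjoint.mul {A A' C C' : Module.End ℚ Fock} (h : IsAdjoint A A') (h' : IsAdjoint C C') :
    IsAdjoint (A * C) (C' * A') := fun x y => by
  rw [Module.End.mul_apply, h, h', Module.End.mul_apply]

theorem IsAdjoint.unique {A A' A'' : Module.End ℚ Fock}
    (h : IsAdjoint A A') (h' : IsAdjoint A A'') :
    A' = A'' := by
  refine LinearMap.ext fun x => form_ext fun S => ?_
  rw [← h, ← h']

theorem IsAdjoint.smul {A A' : Module.End ℚ Fock} (c : ℚ)
    (h : IsAdjoint A A') :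
    IsAdjoint (c • A) (c • A') := fun x y => by
  simp [h x y]

theorem adjoint_sum {ι : Type*} (s : Finset ι) {A A' : ι → Module.End ℚ Fock}
    (h : ∀ i ∈ s, IsAdjoint (A i) (A' i)) :
    IsAdjoint (∑ i ∈ s, A i) (∑ i ∈ s, A' i) := fun x y => by
  simp only [LinearMap.sum_apply, map_sum]
  exact Finset.sum_congr rfl fun i hi => h i hi x y

/-- Adding an element halves the norm `2⁻¹ ^ S.card`, whence the factor 1/2; the signs agree because
`fockSign k` does not see whether `k` itself is present. -/
theorem adjoint_create (k : ℕ) :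
    IsAdjoint (create k) ((2 : ℚ)⁻¹ • annih k) := by
  refine adjoint_of_vec fun S T => ?_
  rw [LinearMap.smul_apply, create_vec, annih_vec]
  by_cases hS : k ∈ S <;> by_cases hT : k ∈ T <;>
    simp only [hS, hT, if_true, if_false, map_zero, LinearMap.zero_apply, smul_zero, map_smul,
      LinearMap.smul_apply, form_vec_vec, smul_eq_mul]
  · rw [if_neg, mul_zero, mul_zero]
    rintro rfl
    simp at hS
  · by_cases h : insert k S = T
    · subst h
      rw [if_pos rfl, if_pos (Finset.erase_insert hS).symm, fockSign_insert hS,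
        Finset.card_insert_of_notMem hS, pow_succ]
      simp
      ring
    · rw [if_neg h, if_neg]
      · simp
      · rintro rfl
        exact h (Finset.insert_erase hT)
  · rw [if_neg, mul_zero]
    rintro rfl
    simp at hT

theorem adjoint_annih (k : ℕ) :
    IsAdjoint (annih k) ((2 : ℚ) • create k) := by
  have := (adjoint_create k).symm.smul 2
  rwa [smul_smul, mul_inv_cancel₀ two_ne_zero, one_smul] at this

theorem adjoint_parity : IsAdjoint parity parity := by
  refine adjoint_of_vec fun S T => ?_
  rw [parity_vec, parity_vec]
  simp only [map_smul, LinearMap.smul_apply, form_vec_vec, smul_eq_mul]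
  split_ifs with h
  · rw [h]
  · simp

/-- The relation for creation operators, carried over by uniqueness of adjoints. -/
theorem annih_anticomm (j k : ℕ) : annih j * annih k + annih k * annih j = 0 := by
  have h := ((adjoint_annih j).mul (adjoint_annih k)).add ((adjoint_annih k).mul (adjoint_annih j))
  have e : (2 : ℚ) • create k * (2 : ℚ) • create j + (2 : ℚ) • create j * (2 : ℚ) • create k =
      0 := by
    rw [smul_mul_smul_comm, smul_mul_smul_comm, ← smul_add, create_anticomm, smul_zero]
  rw [e] at h
  exact h.symm.unique fun x y => by simp

theorem annih_create (j k : ℕ) :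
    annih j * create k = (if j = k then 1 else 0) - create k * annih j := by
  rw [eq_sub_iff_add_eq]
  split_ifs with h
  · rw [h, annih_create_self]
  · exact annih_create_of_ne h

theorem create_create (j k : ℕ) : create j * create k = -(create k * create j) :=
  eq_neg_of_add_eq_zero_left (create_anticomm j k)

theorem annih_annih (j k : ℕ) : annih j * annih k = -(annih k * annih j) :=
  eq_neg_of_add_eq_zero_left (annih_anticomm j k)

theorem shiftUp_create (r j : ℕ) :
    shiftUp r * create j = create j * shiftUp r + create (j + r) := by
  refine hom_ext fun S => ?_
  rw [Module.End.mul_apply, shiftUp_create_vec (Finset.subset_insert j S) (by simp),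
    LinearMap.add_apply, Module.End.mul_apply, shiftUp_vec (Finset.subset_insert j S),
    ← Module.End.mul_apply, ← Module.End.mul_apply, ← LinearMap.add_apply]
  congr 1
  rw [Finset.sum_mul, Finset.mul_sum]
  have : ∀ k, create (k + r) * annih k * create j =
      create j * (create (k + r) * annih k) + if k = j then create (k + r) else 0 := by
    intro k
    rw [mul_assoc, annih_create, mul_sub, ← mul_assoc, create_create _ j, mul_ite, mul_one,
      mul_zero]
    noncomm_ring
  simp only [this, Finset.sum_add_distrib]
  simp

/-- Nothing appears when `j < r`, as the index would become negative. This boundary defect is what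
the other two summands of `mulP` repair. -/
theorem shiftUp_annih (r j : ℕ) :
    shiftUp r * annih j = annih j * shiftUp r - if r ≤ j then annih (j - r) else 0 := by
  refine hom_ext fun S => ?_
  have hs : S ⊆ insert (j - r) S := Finset.subset_insert _ S
  rw [Module.End.mul_apply, shiftUp_annih_vec hs,
    LinearMap.sub_apply, Module.End.mul_apply, shiftUp_vec hs,
    ← Module.End.mul_apply, ← Module.End.mul_apply, ← LinearMap.sub_apply]
  congr 1
  rw [Finset.sum_mul, Finset.mul_sum]
  have : ∀ k, create (k + r) * annih k * annih j =
      annih j * (create (k + r) * annih k) - if j = k + r then annih k else 0 := by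
    intro k
    rw [mul_assoc, annih_annih, mul_neg, ← mul_assoc, ← mul_assoc, annih_create]
    split_ifs <;> noncomm_ring
  simp only [this, Finset.sum_sub_distrib]
  congr 1
  split_ifs with h
  · have e : ∀ k, j = k + r ↔ k = j - r := fun k => by omega
    simp only [e]
    simp
  · exact Finset.sum_eq_zero fun k _ => if_neg (by omega)

theorem shiftUp_parity (r : ℕ) : shiftUp r * parity = parity * shiftUp r := by
  refine hom_ext fun S => ?_
  simp only [Module.End.mul_apply, parity_vec, map_smul, shiftUp_vec (Finset.Subset.refl S)]
  rw [← map_smul, ← parity_vec, ← Module.End.mul_apply, ← Module.End.mul_apply]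
  congr 1
  rw [Finset.sum_mul, Finset.mul_sum]
  refine Finset.sum_congr rfl fun k _ => ?_
  rw [mul_assoc, ← neg_eq_iff_eq_neg.2 (parity_annih k), mul_neg, ← mul_assoc,
    ← mul_assoc, parity_create]
  noncomm_ring

/-- The adjoint of `shiftUp`. -/
noncomputable def shiftDown (r : ℕ) : Module.End ℚ Fock :=
  lift fun S =>
    ∑ k ∈ Finset.range (S.sup id + 1), create k (annih (k + r) (vec S))

theorem shiftDown_vec {S : Finset ℕ} {n : ℕ} (h : S.sup id < n) (r : ℕ) :
    shiftDown r (vec S) = (∑ k ∈ Finset.range n, create k * annih (k + r)) (vec S) := by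
  have : shiftDown r (vec S) =
      ∑ k ∈ Finset.range (S.sup id + 1), create k (annih (k + r) (vec S)) := by
    exact lift_vec _ _
  rw [this, LinearMap.sum_apply]
  refine Finset.sum_subset (by simpa using h) fun k _ hk => ?_
  have : k + r ∉ S := fun hS => by
    have := Finset.le_sup (f := id) hS
    simp at hk this
    omega
  simp [annih_vec, this]

theorem adjoint_shiftUp (r : ℕ) :
    IsAdjoint (shiftUp r) (shiftDown r) := by
  refine adjoint_of_vec fun S T => ?_
  have h1 : S ⊆ Finset.range (max (S.sup id) (T.sup id) + 1) := fun k hk => by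
    have := Finset.le_sup (f := id) hk
    simp at this ⊢
    omega
  rw [shiftUp_vec h1, shiftDown_vec (n := max (S.sup id) (T.sup id) + 1) (by omega)]
  refine adjoint_sum _ (fun k _ => ?_) _ _
  have := (adjoint_create (k + r)).mul (adjoint_annih k)
  rwa [smul_mul_smul_comm, mul_inv_cancel₀ two_ne_zero, one_smul] at this

/-! ### Power sums as quadratic expressions in neutral fermions. -/

/-- The operator on the Fock space that corresponds to multiplication by the power sum `p_r`,
`r` odd. -/
noncomputable def mulP (r : ℕ) : Module.End ℚ Fock :=
  shiftUp r + create (r - 1) * parity +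
    ∑ a ∈ Finset.range (r - 1), (-1 : ℚ) ^ (a + 1) • (create (r - 2 - a) * create a)

/-- The adjoint of `mulP`. -/
noncomputable def mulPAdj (r : ℕ) : Module.End ℚ Fock :=
  shiftDown r + parity * ((2 : ℚ)⁻¹ • annih (r - 1)) +
    ∑ a ∈ Finset.range (r - 1),
      (-1 : ℚ) ^ (a + 1) • (((2 : ℚ)⁻¹ • annih a) * ((2 : ℚ)⁻¹ • annih (r - 2 - a)))

theorem adjoint_mulP (r : ℕ) : IsAdjoint (mulP r) (mulPAdj r) :=
  ((adjoint_shiftUp r).add ((adjoint_create _).mul adjoint_parity)).add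
    (adjoint_sum _ fun _ _ => ((adjoint_create _).mul (adjoint_create _)).smul _)

/-- The summands of `mulP` without annihilators commute with `create j`: moving it past two
anticommuting factors costs no sign. Only `shiftUp` contributes. -/
theorem mulP_create (r j : ℕ) :
    mulP r * create j = create j * mulP r + create (j + r) := by
  have h1 : create (r - 1) * parity * create j = create j * (create (r - 1) * parity) := by
    rw [mul_assoc, parity_create, mul_neg, ← mul_assoc, create_create, neg_mul, neg_neg,
      mul_assoc]
  have h2 : ∀ b a, create b * create a * create j = create j * (create b * create a) := by
    intro b a
    rw [mul_assoc, create_create a j, mul_neg, ← mul_assoc, create_create b j, neg_mul, neg_neg,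
      mul_assoc]
  simp only [mulP, add_mul, mul_add, shiftUp_create, h1, Finset.sum_mul, Finset.mul_sum,
    smul_mul_assoc, mul_smul_comm, h2]
  abel

theorem mulP_parity {r : ℕ} :
    mulP r * parity = parity * mulP r + (2 : ℚ) • create (r - 1) := by
  have h1 : create (r - 1) * parity * parity = parity * (create (r - 1) * parity) +
      (2 : ℚ) • create (r - 1) := by
    rw [← mul_assoc, parity_create, neg_mul, mul_assoc, parity_parity, mul_one, two_smul]
    abel
  have h2 : ∀ b a, create b * create a * parity = parity * (create b * create a) := by
    intro b a
    rw [← mul_assoc, parity_create, neg_mul, mul_assoc, mul_assoc, parity_create, mul_neg, neg_neg]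
  simp only [mulP, add_mul, mul_add, shiftUp_parity, h1, Finset.sum_mul, Finset.mul_sum,
    smul_mul_assoc, mul_smul_comm, h2]
  abel

theorem mulP_annih {r : ℕ} (hr : Odd r) (j : ℕ) :
    mulP r * annih j = annih j * mulP r - (if r ≤ j then annih (j - r) else 0)
      - (if r = j + 1 then parity else 0)
      + (if j + 1 < r then ((2 : ℚ) * (-1) ^ (j + 1)) • create (r - 2 - j) else 0) := by
  have h1 : create (r - 1) * parity * annih j = annih j * (create (r - 1) * parity) -
      (if r = j + 1 then parity else 0) := by
    have hr0 := hr.pos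
    have e : (j = r - 1) ↔ r = j + 1 := by omega
    rw [mul_assoc, parity_annih, ← mul_assoc (annih j), annih_create]
    simp only [e]
    split_ifs <;> noncomm_ring
  have h2 : ∀ b a, create b * create a * annih j = annih j * (create b * create a) +
      (if a = j then create b else 0) - (if b = j then create a else 0) := by
    intro b a
    rw [← mul_assoc, annih_create j b, sub_mul, mul_assoc (create b) (annih j), annih_create]
    simp only [eq_comm (a := j)]
    split_ifs <;> noncomm_ring
  have h3 : ∑ a ∈ Finset.range (r - 1), (-1 : ℚ) ^ (a + 1) •
      ((if a = j then create (r - 2 - a) else 0) - (if r - 2 - a = j then create a else 0)) =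
      (if j + 1 < r then ((2 : ℚ) * (-1) ^ (j + 1)) • create (r - 2 - j) else 0) := by
    simp only [smul_sub, Finset.sum_sub_distrib, smul_ite, smul_zero]
    rw [Finset.sum_ite_eq' (Finset.range (r - 1))]
    -- Within the range of summation, a ↦ r - 2 - a is an honest reflection, so the second delta
    -- also singles out at most one index.
    have e : ∀ a ∈ Finset.range (r - 1),
      (if r - 2 - a = j then (-1 : ℚ) ^ (a + 1) • create a else 0) =
        if a = r - 2 - j then (if j + 1 < r then (-1 : ℚ) ^ (a + 1) • create a else 0) else 0 := by
      intro a ha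
      rw [Finset.mem_range] at ha
      by_cases h : r - 2 - a = j
      · rw [if_pos h, if_pos (by omega), if_pos (by omega)]
      · rw [if_neg h]
        by_cases h' : j + 1 < r
        · rw [if_neg (by omega)]
        · simp [h']
    rw [Finset.sum_congr rfl e, Finset.sum_ite_eq']
    by_cases h : j + 1 < r
    · rw [if_pos (by simp; omega), if_pos (by simp; omega), if_pos h, if_pos h, ← sub_smul]
      congr 1
      obtain ⟨m, rfl⟩ := hr
      -- Here d = r - 2 - j. As r is odd, j + 1 and d have the same parity, so the two delta terms
      -- reinforce each other and give the factor 2.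
      obtain ⟨d, hd⟩ : ∃ d, 2 * m = j + 1 + d := ⟨2 * m - (j + 1), by omega⟩
      have : 2 * m + 1 - 2 - j + 1 = d + 1 := by omega
      rw [this]
      have : (-1 : ℚ) ^ (j + 1 + d) = 1 := by rw [← hd, pow_mul]; simp
      rw [pow_add] at this
      rcases neg_one_pow_eq_or ℚ d with h | h <;> rw [h] at this <;> rw [pow_succ (-1 : ℚ) d, h]
      · rw [mul_one] at this; rw [this]; norm_num
      · have : (-1 : ℚ) ^ (j + 1) = -1 := by linarith
        rw [this]; norm_num
    · rw [if_neg (by simp; omega), if_neg h, if_neg h]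
      simp
  simp only [mulP, add_mul, mul_add, shiftUp_annih, h1, Finset.sum_mul, Finset.mul_sum,
    smul_mul_assoc, mul_smul_comm, h2]
  rw [← h3]
  simp only [add_sub_assoc, smul_add, Finset.sum_add_distrib]
  abel

/-- The modes of the neutral fermion field. -/
noncomputable def mode : ℤ → Module.End ℚ Fock
  | Int.ofNat 0 => (2 : ℚ)⁻¹ • parity
  | Int.ofNat (k + 1) => create k
  | Int.negSucc k => ((2 : ℚ)⁻¹ * (-1) ^ (k + 1)) • annih k

theorem mode_succ (k : ℕ) : mode (k + 1 : ℤ) = create k := rfl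
theorem mode_zero : mode 0 = (2 : ℚ)⁻¹ • parity := rfl
theorem mode_neg (k : ℕ) : mode (-(k + 1 : ℤ)) = ((2 : ℚ)⁻¹ * (-1) ^ (k + 1)) • annih k := rfl

theorem int_cases (j : ℤ) : j = 0 ∨ (∃ k : ℕ, j = k + 1) ∨ ∃ k : ℕ, j = -(k + 1) := by
  rcases lt_trichotomy j 0 with h | h | h
  · exact Or.inr (Or.inr ⟨(-j - 1).toNat, by omega⟩)
  · exact Or.inl h
  · exact Or.inr (Or.inl ⟨(j - 1).toNat, by omega⟩)

/-- Uniform form of the three preceding commutators. From a negative mode the shifted index j + r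
may be negative, zero or positive, and the three summands of `mulP` supply these cases in turn; the
normalizations of `mode` are chosen for this. Oddness of r matches the alternating signs. -/
theorem mulP_mode {r : ℕ} (hr : Odd r) (j : ℤ) :
    mulP r * mode j = mode j * mulP r + mode (j + r) := by
  have hr0 := hr.pos
  rcases int_cases j with rfl | ⟨k, rfl⟩ | ⟨k, rfl⟩
  · have : (0 + r : ℤ) = (r - 1 : ℕ) + 1 := by omega
    rw [this, mode_succ, mode_zero, mul_smul_comm, smul_mul_assoc, mulP_parity, smul_add, smul_smul]
    norm_num
  · have : (k + 1 + r : ℤ) = (k + r : ℕ) + 1 := by omega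
    rw [this, mode_succ, mode_succ, mulP_create]
  · rw [mode_neg, mul_smul_comm, mulP_annih hr, smul_mul_assoc]
    rcases lt_trichotomy r (k + 1) with h | h | h
    · have e : (-(k + 1) + r : ℤ) = -((k - r : ℕ) + 1) := by omega
      rw [e, mode_neg, if_pos (by omega), if_neg (by omega), if_neg (by omega)]
      have : (-1 : ℚ) ^ (k + 1) = -(-1) ^ (k - r + 1) := by
        have : k + 1 = (k - r + 1) + r := by omega
        rw [this, pow_add, hr.neg_one_pow]; ring
      rw [this]
      module
    · have e : (-(k + 1) + r : ℤ) = 0 := by omega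
      rw [e, mode_zero, if_neg (by omega), if_pos h, if_neg (by omega), ← h, hr.neg_one_pow]
      module
    · have e : (-(k + 1) + r : ℤ) = ((r - 2 - k : ℕ) + 1) := by omega
      rw [e, mode_succ, if_neg (by omega), if_neg (by omega), if_pos (by omega)]
      rw [sub_zero, sub_zero, smul_add, smul_smul]
      congr 1
      rcases neg_one_pow_eq_or ℚ (k + 1) with h | h <;> rw [h] <;> norm_num

end Fock

/-! ### Commutation relations from irreducibility. -/

namespace Fock

/-- The vacuum vector. -/
noncomputable def vac : Fock := vec ∅

theorem annih_vac (k : ℕ) : annih k vac = 0 := by simp [vac, annih_vec]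

theorem parity_vac : parity vac = vac := by simp [vac, parity_vec]

theorem vec_insert {k : ℕ} {S : Finset ℕ} (h : k ∉ S) :
    vec (insert k S) = fockSign k S • create k (vec S) := by
  rw [create_vec, if_neg h, smul_smul, fockSign_mul_self, one_smul]

theorem form_vac (x : Fock) : form vac x = coeff ∅ x := by simp [vac, form_vec]

theorem adjoint_mode (j : ℤ) : IsAdjoint (mode j) ((-1 : ℚ) ^ j • mode (-j)) := by
  rcases int_cases j with rfl | ⟨k, rfl⟩ | ⟨k, rfl⟩
  · simpa [mode_zero] using adjoint_parity.smul 2⁻¹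
  · have e : ((-1 : ℚ) ^ ((k : ℤ) + 1)) = (-1) ^ (k + 1) := by
      rw [← zpow_natCast, Nat.cast_succ]
    rw [mode_succ, mode_neg, smul_smul, e]
    have : (-1 : ℚ) ^ (k + 1) * (2⁻¹ * (-1) ^ (k + 1)) = 2⁻¹ := by
      rcases neg_one_pow_eq_or ℚ (k + 1) with h | h <;> rw [h] <;> norm_num
    rw [this]
    exact adjoint_create k
  · have e : ((-1 : ℚ) ^ (-((k : ℤ) + 1))) = (-1) ^ (k + 1) := by
      rw [zpow_neg, ← inv_zpow]
      exact_mod_cast (by norm_num : ((-1 : ℚ)⁻¹ ^ (k + 1)) = _)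
    rw [neg_neg, mode_succ, mode_neg, e]
    have := (adjoint_annih k).smul (2⁻¹ * (-1) ^ (k + 1))
    rw [smul_smul] at this
    rwa [show (2 : ℚ)⁻¹ * (-1) ^ (k + 1) * 2 = (-1) ^ (k + 1) by ring] at this

/-- Adjoint of `mulP_mode`; reversing the order of the commutator costs a sign, which (-1)^r = -1
compensates. -/
theorem mulPAdj_mode {r : ℕ} (hr : Odd r) (j : ℤ) :
    mulPAdj r * mode j = mode j * mulPAdj r + mode (j - r) := by
  have h1 := ((adjoint_mulP r).symm.mul (adjoint_mode j)).symm
  have h2 := (((adjoint_mode j).mul (adjoint_mulP r).symm).add (adjoint_mode (j - r))).symm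
  refine h1.unique ?_
  convert h2 using 1
  rw [mul_smul_comm, mulP_mode hr, zpow_sub₀ (by norm_num), zpow_natCast, hr.neg_one_pow,
    smul_mul_assoc, smul_add, neg_sub, neg_add_eq_sub]
  module

/-- Schur's lemma. `T vac` is killed by every annihilator, hence orthogonal to every basis vector
but the vacuum; so it is a multiple of `vac`, and creation operators carry this scalar to the whole
space. -/
theorem eq_smul_one_of_commute {T : Module.End ℚ Fock}
    (h : ∀ j, T * mode j = mode j * T) : T = coeff ∅ (T vac) • 1 := by
  have hc : ∀ k x, T (create k x) = create k (T x) := fun k x => by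
    have := LinearMap.congr_fun (h (k + 1)) x
    rwa [mode_succ, Module.End.mul_apply, Module.End.mul_apply] at this
  have ha : ∀ k x, T (annih k x) = annih k (T x) := fun k x => by
    have := LinearMap.congr_fun (h (-(k + 1))) x
    simp only [mode_neg, mul_smul_comm, smul_mul_assoc, LinearMap.smul_apply,
      Module.End.mul_apply] at this
    exact smul_right_injective _ (by simp) this
  have hv : T vac = coeff ∅ (T vac) • vac := by
    refine form_ext fun S => ?_
    induction S using Finset.induction_on with
    | empty => simp [form_vec, vac, coeff_vec]
    | insert k S hk _ =>
      rw [vec_insert hk, map_smul, LinearMap.smul_apply, LinearMap.smul_apply, adjoint_create,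
        adjoint_create]
      simp only [LinearMap.smul_apply, ← ha, annih_vac, map_smul, map_zero, smul_zero]
  refine hom_ext fun S => ?_
  induction S using Finset.induction_on with
  | empty => exact hv
  | insert k S hk ih =>
    rw [vec_insert hk, map_smul, hc, ih]
    simp

theorem shiftUp_vac (r : ℕ) : shiftUp r vac = 0 := by
  rw [vac, shiftUp_vec (Finset.Subset.refl _)]
  simp

theorem mulP_vac (r : ℕ) :
    mulP r vac = create (r - 1) vac +
      ∑ a ∈ Finset.range (r - 1), (-1 : ℚ) ^ (a + 1) • create (r - 2 - a) (create a vac) := by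
  simp [mulP, shiftUp_vac, LinearMap.sum_apply, parity_vac]

theorem mulPAdj_vac (r : ℕ) : mulPAdj r vac = 0 := by
  have : shiftDown r vac = 0 := by
    rw [vac, shiftDown_vec (Nat.lt_succ_self _)]
    simp only [LinearMap.sum_apply, Module.End.mul_apply]
    exact Finset.sum_eq_zero fun k _ => by rw [← vac, annih_vac, map_zero]
  simp [mulPAdj, this, LinearMap.sum_apply, annih_vac]

theorem coeff_empty_mulP (r : ℕ) (x : Fock) : coeff ∅ (mulP r x) = 0 := by
  rw [← form_vac, ← (adjoint_mulP r).symm, mulPAdj_vac, map_zero, LinearMap.zero_apply]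

/-- Each factor shifts the modes, and shifts commute, so the commutator is a scalar. It vanishes
because products of the `mulP` have no vacuum component. -/
theorem mulP_commute {r s : ℕ} (hr : Odd r) (hs : Odd s) :
    mulP r * mulP s = mulP s * mulP r := by
  have h := eq_smul_one_of_commute (T := mulP r * mulP s - mulP s * mulP r) fun j => by
    have e : ∀ A C : Module.End ℚ Fock, ∀ a c, (∀ j, A * mode j = mode j * A + mode (j + a)) →
        (∀ j, C * mode j = mode j * C + mode (j + c)) → A * C * mode j = mode j * (A * C) +
        mode (j + a) * C + mode (j + c) * A + mode (j + c + a) := fun A C a c hA hC => by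
      rw [mul_assoc, hC, mul_add, hA, ← mul_assoc, hA, add_mul, mul_assoc]
      abel
    rw [sub_mul, e _ _ _ _ (mulP_mode hr) (mulP_mode hs), e _ _ _ _ (mulP_mode hs) (mulP_mode hr),
      mul_sub, add_right_comm j]
    abel
  rw [LinearMap.sub_apply, map_sub, Module.End.mul_apply, Module.End.mul_apply, coeff_empty_mulP,
    coeff_empty_mulP, sub_zero, zero_smul] at h
  exact sub_eq_zero.1 h

theorem mode_neg_vac {j : ℤ} (hj : j < 0) : mode j vac = 0 := by
  rcases int_cases j with rfl | ⟨k, rfl⟩ | ⟨k, rfl⟩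
  · omega
  · omega
  · rw [mode_neg, LinearMap.smul_apply, annih_vac, smul_zero]

/-- For r = s the linear term and each of the r - 1 quadratic terms of `mulP_vac` give 1/2, in total
r/2. The assumption s ≤ r makes the remaining shifted modes negative, so that they annihilate the
vacuum. -/
theorem mulPAdj_mulP_vac {r s : ℕ} (hr : Odd r) (hs : Odd s) (hsr : s ≤ r) :
    mulPAdj r (mulP s vac) = if r = s then ((r : ℚ) / 2) • vac else 0 := by
  have hs0 := hs.pos
  have hK : ∀ k x, mulPAdj r (create k x) = create k (mulPAdj r x) + mode (k + 1 - r) x :=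
    fun k x => by
      have := LinearMap.congr_fun (mulPAdj_mode hr (k + 1)) x
      rwa [mode_succ, LinearMap.add_apply, Module.End.mul_apply, Module.End.mul_apply] at this
  have h1 : mode ((s - 1 : ℕ) + 1 - r) vac = if r = s then (2 : ℚ)⁻¹ • vac else 0 := by
    split_ifs with h
    · have : (((s - 1 : ℕ) : ℤ) + 1 - r) = 0 := by omega
      rw [this, mode_zero, LinearMap.smul_apply, parity_vac]
    · exact mode_neg_vac (by omega)
  have h2 : ∀ a ∈ Finset.range (s - 1), (-1 : ℚ) ^ (a + 1) •
      mulPAdj r (create (s - 2 - a) (create a vac)) =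
        if r = s then (2 : ℚ)⁻¹ • vac else 0 := by
    intro a ha
    rw [Finset.mem_range] at ha
    rw [hK, hK, mulPAdj_vac, mode_neg_vac (by omega)]
    have e : (((s - 2 - a : ℕ) : ℤ) + 1 - r) = -((r - s + a : ℕ) + 1) := by omega
    have e2 : annih (r - s + a) (create a vac) = if r = s then vac else 0 := by
      rw [← Module.End.mul_apply, annih_create, LinearMap.sub_apply, Module.End.mul_apply,
        annih_vac, map_zero, sub_zero]
      by_cases h : r = s
      · rw [if_pos h, if_pos (by omega), Module.End.one_apply]
      · rw [if_neg h, if_neg (by omega), LinearMap.zero_apply]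
    rw [e, mode_neg, LinearMap.smul_apply, e2]
    by_cases h : r = s
    · subst h
      simp only [map_zero, zero_add, if_true, smul_smul, Nat.sub_self, add_zero]
      congr 1
      rcases neg_one_pow_eq_or ℚ (a + 1) with h | h <;> rw [h] <;> norm_num
    · simp [h]
  rw [mulP_vac, map_add, map_sum, hK, mulPAdj_vac, map_zero, zero_add, h1]
  simp only [map_smul]
  rw [Finset.sum_congr rfl h2]
  by_cases h : r = s
  · simp only [h, if_true, Finset.sum_const, Finset.card_range, ← Nat.cast_smul_eq_nsmul ℚ]
    rw [Nat.cast_sub hs0]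
    module
  · simp [h]

/-- The Heisenberg relation: again the commutator is a scalar, read off at the vacuum. The case r <
s reduces to s < r by symmetry of the form. -/
theorem mulPAdj_mulP {r s : ℕ} (hr : Odd r) (hs : Odd s) :
    mulPAdj r * mulP s = mulP s * mulPAdj r + (if r = s then (r : ℚ) / 2 else 0) • 1 := by
  have h := eq_smul_one_of_commute (T := mulPAdj r * mulP s - mulP s * mulPAdj r) fun j => by
    have e : ∀ A C : Module.End ℚ Fock, ∀ a c, (∀ j, A * mode j = mode j * A + mode (j + a)) →
        (∀ j, C * mode j = mode j * C + mode (j + c)) → A * C * mode j = mode j * (A * C) +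
        mode (j + a) * C + mode (j + c) * A + mode (j + c + a) := fun A C a c hA hC => by
      rw [mul_assoc, hC, mul_add, hA, ← mul_assoc, hA, add_mul, mul_assoc]
      abel
    have hK : ∀ j, mulPAdj r * mode j = mode j * mulPAdj r + mode (j + -r) := fun j =>
      mulPAdj_mode hr j
    rw [sub_mul, e _ _ _ _ hK (mulP_mode hs), e _ _ _ _ (mulP_mode hs) hK,
      mul_sub, add_right_comm j]
    abel
  rw [LinearMap.sub_apply, map_sub, Module.End.mul_apply, Module.End.mul_apply, coeff_empty_mulP,
    sub_zero] at h
  rw [← sub_eq_iff_eq_add', h]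
  congr 1
  have key : ∀ r s : ℕ, Odd r → Odd s → s ≤ r → coeff ∅ (mulPAdj r (mulP s vac)) =
      if r = s then (r : ℚ) / 2 else 0 := by
    intro r s hr hs hsr
    rw [mulPAdj_mulP_vac hr hs hsr]
    split_ifs <;> simp [vac, coeff_vec]
  rcases le_total s r with hsr | hsr
  · exact key r s hr hs hsr
  · rw [← form_vac, ← adjoint_mulP, form_comm, adjoint_mulP, form_vac, key s r hs hr hsr]
    by_cases h : r = s
    · simp [h]
    · simp [h, Ne.symm h]

/-- The operator measuring the size of strict partitions. -/
noncomputable def sizeOp : Module.End ℚ Fock := weightOp fun k => k + 1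

theorem adjoint_diag (f : Finset ℕ → ℚ) : IsAdjoint (diag f) (diag f) := by
  refine adjoint_of_vec fun S T => ?_
  rw [diag_vec, diag_vec]
  simp only [map_smul, LinearMap.smul_apply, form_vec_vec, smul_eq_mul]
  split_ifs with h
  · rw [h]
  · simp

theorem sizeOp_mode (j : ℤ) : sizeOp * mode j = mode j * sizeOp + (j : ℚ) • mode j := by
  rcases int_cases j with rfl | ⟨k, rfl⟩ | ⟨k, rfl⟩
  · refine hom_ext fun S => ?_
    simp [mode_zero, Module.End.mul_apply, sizeOp, weightOp, parity, diag_vec, smul_smul]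
    congr 1
    ring
  · have := weightOp_create (fun k => (k + 1 : ℚ)) k
    rw [mode_succ]
    push_cast
    exact this
  · have h := (adjoint_diag fun S => ∑ k ∈ S, ((k : ℚ) + 1)).mul (adjoint_create k)
    have h' := (((adjoint_create k).mul (adjoint_diag fun S => ∑ k ∈ S, ((k : ℚ) + 1))).add
      ((adjoint_create k).smul ((k : ℚ) + 1)))
    have hc := weightOp_create (fun k => (k + 1 : ℚ)) k
    simp only [weightOp] at hc
    rw [hc] at h
    have := h.unique h'
    rw [mode_neg, sizeOp, weightOp]
    rw [smul_mul_assoc, mul_smul_comm] at this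
    have e : annih k * diag (fun S => ∑ k ∈ S, ((k : ℚ) + 1)) =
        diag (fun S => ∑ k ∈ S, ((k : ℚ) + 1)) * annih k + ((k : ℚ) + 1) • annih k := by
      have := congrArg (fun A => (2 : ℚ) • A) this
      simpa [smul_smul, smul_add, mul_comm ((k : ℚ) + 1)] using this
    rw [smul_mul_assoc, mul_smul_comm, e]
    push_cast
    module

theorem sizeOp_vac : sizeOp vac = 0 := by
  simp [sizeOp, weightOp, vac, diag_vec]

theorem coeff_sizeOp (S : Finset ℕ) (x : Fock) :
    coeff S (sizeOp x) = (∑ k ∈ S, ((k : ℚ) + 1)) * coeff S x := by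
  have h := adjoint_diag (fun S => ∑ k ∈ S, ((k : ℚ) + 1)) (vec S) x
  rw [diag_vec, map_smul, LinearMap.smul_apply, form_vec, form_vec] at h
  have : (2 : ℚ)⁻¹ ^ S.card ≠ 0 := by positivity
  apply mul_left_cancel₀ this
  rw [sizeOp, weightOp, ← h, smul_eq_mul]
  ring

/-- Both sides have the same commutators with all modes and no vacuum component on `vac`, so Schur's
lemma applies once more. -/
theorem sizeOp_mulP {r : ℕ} (hr : Odd r) :
    sizeOp * mulP r = mulP r * sizeOp + (r : ℚ) • mulP r := by
  have h := eq_smul_one_of_commute (T := sizeOp * mulP r - mulP r * sizeOp - (r : ℚ) • mulP r)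
    fun j => by
      simp only [sub_mul, mul_sub, smul_mul_assoc, mul_smul_comm, mulP_mode hr]
      simp only [mul_assoc, mulP_mode hr, sizeOp_mode, mul_add, mul_smul_comm]
      simp only [← mul_assoc, mulP_mode hr, sizeOp_mode, add_mul, smul_mul_assoc]
      push_cast
      module
  have e : coeff ∅ ((sizeOp * mulP r - mulP r * sizeOp - (r : ℚ) • mulP r) vac) = 0 := by
    simp only [LinearMap.sub_apply, LinearMap.smul_apply, Module.End.mul_apply, map_sub, map_smul,
      coeff_empty_mulP, coeff_sizeOp]
    simp
  rw [e, zero_smul] at h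
  rw [← sub_eq_zero, ← h]
  abel

/-! ### Products of power sums and their scalar products. -/

/-- The vector that corresponds to the product of the power sums of the listed degrees. -/
noncomputable def powerVec : List ℕ → Fock
  | [] => vac
  | r :: l => mulP r (powerVec l)

theorem powerVec_perm {l l' : List ℕ} (h : l.Perm l') (hl : ∀ r ∈ l, Odd r) :
    powerVec l = powerVec l' := by
  induction h with
  | nil => rfl
  | cons r _ ih => rw [powerVec, powerVec, ih fun s hs => hl s (List.mem_cons_of_mem _ hs)]
  | swap r s l =>
    exact LinearMap.congr_fun (mulP_commute (hl s (by simp)) (hl r (by simp))) _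
  | trans h1 _ ih1 ih2 =>
    rw [ih1 hl, ih2 fun r hr => hl r (h1.mem_iff.2 hr)]

theorem sizeOp_powerVec {l : List ℕ} (hl : ∀ r ∈ l, Odd r) :
    sizeOp (powerVec l) = (l.sum : ℚ) • powerVec l := by
  induction l with
  | nil => simp [powerVec, sizeOp_vac]
  | cons r l ih =>
    have := LinearMap.congr_fun (sizeOp_mulP (hl r (by simp))) (powerVec l)
    rw [powerVec, ← Module.End.mul_apply, this, LinearMap.add_apply, Module.End.mul_apply,
      ih fun s hs => hl s (List.mem_cons_of_mem _ hs), map_smul, LinearMap.smul_apply,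
      List.sum_cons]
    push_cast
    module

/-- By the Heisenberg relation the adjoint of p_r acts as the derivation (r/2) ∂/∂p_r. -/
theorem mulPAdj_powerVec {r : ℕ} (hr : Odd r) {l : List ℕ} (hl : ∀ s ∈ l, Odd s) :
    mulPAdj r (powerVec l) = ((r : ℚ) / 2 * l.count r) • powerVec (l.erase r) := by
  induction l with
  | nil => simp [powerVec, mulPAdj_vac]
  | cons s l ih =>
    have hl' : ∀ t ∈ l, Odd t := fun t ht => hl t (List.mem_cons_of_mem _ ht)
    rw [powerVec, ← Module.End.mul_apply, mulPAdj_mulP hr (hl s (by simp)), LinearMap.add_apply,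
      Module.End.mul_apply, ih hl', map_smul, LinearMap.smul_apply, Module.End.one_apply]
    by_cases h : r = s
    · subst h
      rw [if_pos rfl, List.count_cons_self, List.erase_cons_head]
      by_cases hm : r ∈ l
      · have : mulP r (powerVec (l.erase r)) = powerVec l :=
          powerVec_perm (List.perm_cons_erase hm).symm fun t ht =>
            hl t ((List.perm_cons_erase hm).cons r |>.mem_iff.2 (List.mem_cons_of_mem _ ht))
        rw [this]
        push_cast
        module
      · rw [List.count_eq_zero_of_not_mem hm]
        simp
    · rw [if_neg h, List.count_cons_of_ne (Ne.symm h), List.erase_cons_tail (by simpa using Ne.symm h),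
        powerVec, zero_smul, add_zero]

/-- `∏ r ^ m_r * m_r !` over the multiplicities `m_r` of the entries of a list. -/
def listZ (l : List ℕ) : ℕ := ∏ r ∈ l.toFinset, r ^ l.count r * (l.count r).factorial

theorem listZ_eq_prod {l : List ℕ} {T : Finset ℕ} (h : l.toFinset ⊆ T) :
    listZ l = ∏ r ∈ T, r ^ l.count r * (l.count r).factorial := by
  refine Finset.prod_subset h fun r _ hr => ?_
  rw [List.mem_toFinset] at hr
  simp [List.count_eq_zero_of_not_mem hr]

theorem listZ_cons (r : ℕ) (l : List ℕ) : listZ (r :: l) = r * (l.count r + 1) * listZ l := by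
  rw [listZ_eq_prod (Finset.Subset.refl _), listZ_eq_prod (l := l) (T := (r :: l).toFinset)
    (by intro x; simp; tauto), ← Finset.mul_prod_erase _ _ (a := r) (by simp),
    ← Finset.mul_prod_erase _ (fun x => x ^ l.count x * (l.count x).factorial) (a := r) (by simp)]
  have : ∀ s ∈ ((r :: l).toFinset).erase r, s ^ (r :: l).count s * ((r :: l).count s).factorial =
      s ^ l.count s * (l.count s).factorial := fun s hs => by
    rw [List.count_cons_of_ne (Finset.ne_of_mem_erase hs).symm]
  rw [Finset.prod_congr rfl this, List.count_cons_self, pow_succ, Nat.factorial_succ]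
  ring

theorem form_powerVec {l l' : List ℕ} (hl : ∀ r ∈ l, Odd r) (hl' : ∀ r ∈ l', Odd r) :
    form (powerVec l) (powerVec l') = if l.Perm l' then (listZ l : ℚ) / 2 ^ l.length else 0 := by
  induction l generalizing l' with
  | nil =>
    rw [powerVec, form_vac]
    cases l' with
    | nil => simp [powerVec, vac, coeff_vec, listZ]
    | cons r l' => rw [powerVec, coeff_empty_mulP, if_neg (by simp)]
  | cons r l ih =>
    have hr := hl r (by simp)
    rw [powerVec, adjoint_mulP, mulPAdj_powerVec hr hl', map_smul,
      ih (fun s hs => hl s (List.mem_cons_of_mem _ hs)) fun s hs => hl' s (List.mem_of_mem_erase hs)]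
    by_cases hm : r ∈ l'
    · have hp := List.perm_cons_erase hm
      have e : (r :: l).Perm l' ↔ l.Perm (l'.erase r) :=
        ⟨fun h => List.cons_perm_iff_perm_erase.1 h |>.2, fun h => (h.cons r).trans hp.symm⟩
      simp only [e]
      split_ifs with h
      · have : l'.count r = l.count r + 1 := by
          rw [hp.count_eq, List.count_cons_self, h.count_eq]
        rw [this, listZ_cons, List.length_cons, pow_succ, smul_eq_mul]
        push_cast
        field_simp
      · simp
    · rw [List.count_eq_zero_of_not_mem hm, if_neg fun h : (r :: l).Perm l' => hm (h.subset (by simp))]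
      simp

end Fock

/-! ### Symmetrizations over a field and partial fractions. -/

open Polynomial in
/-- The homogeneous case and the factorial case of the symmetrization are covered by a family of
polynomials `u`; this is the sum over all injective assignments of elements of `s` to the entries
of the list. -/
noncomputable def symSum {ι F : Type} [DecidableEq ι] [Field F] [Algebra ℚ F] (x : ι → F) :
    List ℚ[X] → Finset ι → F
  | [], _ => 1
  | u :: us, s => ∑ i ∈ s, aeval (x i) u * (∏ j ∈ s.erase i, (x i + x j) / (x i - x j)) *
      symSum x us (s.erase i)

/-- The coordinates are distinct and no two of them add up to zero. -/
structure IsGeneric {ι F : Type} [Field F] (x : ι → F) : Prop where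
  sub_ne : ∀ i j, i ≠ j → x i - x j ≠ 0
  add_ne : ∀ i j, x i + x j ≠ 0

theorem IsGeneric.ne_zero {ι F : Type} [Field F] {x : ι → F} (hx : IsGeneric x) (i : ι) :
    x i ≠ 0 := fun h => hx.add_ne i i (by simp [h])

section

open Polynomial

variable {ι F : Type} [DecidableEq ι] [Field F] {x : ι → F}

/-- The product `∏ (x_i + x_j) / (x_i - x_j)` over the `j ≠ i` in `s`. -/
noncomputable def ratioProd (x : ι → F) (i : ι) (s : Finset ι) : F :=
  ∏ j ∈ s.erase i, (x i + x j) / (x i - x j)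

theorem sum_erase_comm (s : Finset ι) (f : ι → ι → F) :
    ∑ i ∈ s, ∑ j ∈ s.erase i, f i j = ∑ i ∈ s, ∑ j ∈ s.erase i, f j i :=
  Finset.sum_comm' fun i j => by simp only [Finset.mem_erase]; tauto

/-- The generating polynomial of the elementary symmetric functions of `x` on `s`. -/
noncomputable def elemPoly {κ R : Type} [CommRing R] (x : κ → R) (s : Finset κ) : R[X] :=
  ∏ j ∈ s, (1 + C (x j) * X)

theorem elemPoly_erase {R : Type} [CommRing R] (x : ι → R) {s : Finset ι} {i : ι} (hi : i ∈ s) :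
    elemPoly x s = (1 + C (x i) * X) * elemPoly x (s.erase i) :=
  (Finset.mul_prod_erase s _ hi).symm

theorem natDegree_prod_le_card {κ R : Type} [CommRing R] (f : κ → R[X]) (s : Finset κ)
    (h : ∀ i ∈ s, (f i).natDegree ≤ 1) : (∏ i ∈ s, f i).natDegree ≤ s.card :=
  (natDegree_prod_le s f).trans ((Finset.sum_le_sum h).trans (by simp))

theorem natDegree_elemPoly {κ R : Type} [CommRing R] (x : κ → R) (s : Finset κ) :
    (elemPoly x s).natDegree ≤ s.card :=
  natDegree_prod_le_card _ _ fun i _ => by compute_degree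

/-- The partial fraction expansion of ∏ (1 - x_j X)/(1 + x_j X) with denominators cleared. Both
sides have degree at most |s| and agree at the |s| + 1 points 0 and -1/x_i, which genericity makes
distinct. -/
theorem partial_fractions (hx : IsGeneric x) (s : Finset ι) :
    ∏ j ∈ s, (1 - C (x j) * X) = elemPoly x s -
      X * ∑ j ∈ s, C (2 * (x j * ratioProd x j s)) * elemPoly x (s.erase j) := by
  classical
  have h1 : (∏ j ∈ s, (1 - C (x j) * X)).natDegree ≤ s.card :=
    natDegree_prod_le_card _ _ fun i _ => by compute_degree
  have h2 : (elemPoly x s -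
      X * ∑ j ∈ s, C (2 * (x j * ratioProd x j s)) * elemPoly x (s.erase j)).natDegree ≤ s.card := by
    refine (natDegree_sub_le _ _).trans (max_le (natDegree_elemPoly x s) ?_)
    rcases s.eq_empty_or_nonempty with rfl | hs
    · simp
    have hc := hs.card_pos
    refine natDegree_mul_le.trans ?_
    have : (∑ j ∈ s, C (2 * (x j * ratioProd x j s)) * elemPoly x (s.erase j)).natDegree ≤
        s.card - 1 := by
      refine natDegree_sum_le_of_forall_le _ _ fun j hj => (natDegree_C_mul_le _ _).trans ?_
      rw [← Finset.card_erase_of_mem hj]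
      exact natDegree_elemPoly x _
    rw [natDegree_X]
    omega
  have hinj : Set.InjOn (fun j => -(x j)⁻¹) s := fun i _ j _ h => by
    by_contra hij
    exact hx.sub_ne i j hij (sub_eq_zero.2 (inv_injective (neg_injective h)))
  have h0 : (0 : F) ∉ s.image fun j => -(x j)⁻¹ := by
    simp only [Finset.mem_image, not_exists, not_and]
    intro j _ h
    exact hx.ne_zero j (by simpa using h)
  have hcard : (insert 0 (s.image fun j => -(x j)⁻¹)).card = s.card + 1 := by
    rw [Finset.card_insert_of_notMem h0, Finset.card_image_of_injOn hinj]
  refine eq_of_degrees_lt_of_eval_finset_eq (insert 0 (s.image fun j => -(x j)⁻¹)) ?_ ?_ ?_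
  · rw [hcard]
    exact degree_le_natDegree.trans_lt (by exact_mod_cast Nat.lt_succ_of_le h1)
  · rw [hcard]
    exact degree_le_natDegree.trans_lt (by exact_mod_cast Nat.lt_succ_of_le h2)
  · intro z hz
    rw [Finset.mem_insert, Finset.mem_image] at hz
    rcases hz with rfl | ⟨i, hi, rfl⟩
    · simp [elemPoly, eval_prod]
    · have hxi := hx.ne_zero i
      have e1 : ∀ j ∈ s, i ∈ s.erase j → eval (-(x i)⁻¹) (elemPoly x (s.erase j)) = 0 := by
        intro j _ hij
        rw [elemPoly, eval_prod]
        exact Finset.prod_eq_zero hij (by simp [hxi])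
      have e2 : eval (-(x i)⁻¹) (elemPoly x s) = 0 := by
        rw [elemPoly, eval_prod]
        exact Finset.prod_eq_zero hi (by simp [hxi])
      rw [eval_sub, e2, eval_mul, eval_X, eval_finsetSum, Finset.sum_eq_single_of_mem i hi]
      · rw [eval_mul, eval_C, elemPoly, eval_prod, eval_prod, ratioProd,
          ← Finset.mul_prod_erase s _ hi]
        simp only [eval_sub, eval_add, eval_mul, eval_one, eval_C, eval_X]
        have e3 : ∏ j ∈ s.erase i, (1 - x j * -(x i)⁻¹) =
            (∏ j ∈ s.erase i, (x i + x j) / (x i - x j)) *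
              ∏ j ∈ s.erase i, (1 + x j * -(x i)⁻¹) := by
          rw [← Finset.prod_mul_distrib]
          refine Finset.prod_congr rfl fun j hj => ?_
          have := hx.sub_ne i j (Finset.ne_of_mem_erase hj).symm
          field_simp
          ring
        rw [e3]
        field_simp
        ring
      · intro j hj hji
        rw [eval_mul, e1 j hj (Finset.mem_erase.2 ⟨hji.symm, hi⟩), mul_zero]

/-- Partial fractions for `s.erase i` at X = 1/x_i, divided by ∏ (1 - x_j/x_i). -/
theorem ratioProd_eq (hx : IsGeneric x) (s : Finset ι) (i : ι) :
    ratioProd x i s = 1 + 2 * ∑ j ∈ s.erase i, x j / (x i - x j) *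
      (ratioProd x j (s.erase i) * ∏ k ∈ (s.erase i).erase j, (x i + x k) / (x i - x k)) := by
  have hxi := hx.ne_zero i
  have h := congrArg (eval (x i)⁻¹) (partial_fractions hx (s.erase i))
  simp only [elemPoly, eval_sub, eval_mul, eval_X, eval_finsetSum, eval_C, eval_prod, eval_one,
    eval_add] at h
  have hm : ∀ t ⊆ s.erase i, ∏ j ∈ t, (1 - x j * (x i)⁻¹) ≠ 0 := by
    intro t ht
    refine Finset.prod_ne_zero_iff.2 fun j hj => ?_
    have := hx.sub_ne i j (Finset.ne_of_mem_erase (ht hj)).symm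
    rw [← div_eq_mul_inv, one_sub_div hxi]
    exact div_ne_zero this hxi
  have hd : ∀ t ⊆ s.erase i, ∏ j ∈ t, (x i + x j) / (x i - x j) =
      (∏ j ∈ t, (1 + x j * (x i)⁻¹)) / ∏ j ∈ t, (1 - x j * (x i)⁻¹) := by
    intro t ht
    rw [← Finset.prod_div_distrib]
    refine Finset.prod_congr rfl fun j hj => ?_
    have := hx.sub_ne i j (Finset.ne_of_mem_erase (ht hj)).symm
    field_simp
  have hs := hm _ (Finset.Subset.refl _)
  rw [ratioProd, hd _ (Finset.Subset.refl _), div_eq_iff hs, add_mul, one_mul,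
    ← sub_eq_iff_eq_add']
  nth_rewrite 1 [h]
  rw [sub_sub_cancel,
    Finset.mul_sum, Finset.mul_sum, Finset.sum_mul]
  refine Finset.sum_congr rfl fun j hj => ?_
  rw [hd _ (Finset.erase_subset j _), ← Finset.mul_prod_erase _ (fun j => 1 - x j * (x i)⁻¹) hj]
  have h1 := hm _ (Finset.erase_subset j _)
  have h2 := hx.sub_ne i j (Finset.ne_of_mem_erase hj).symm
  generalize ∏ k ∈ (s.erase i).erase j, (1 - x k * (x i)⁻¹) = p at h1 ⊢
  generalize ∏ k ∈ (s.erase i).erase j, (1 + x k * (x i)⁻¹) = q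
  have h3 : x i * (1 - x j * (x i)⁻¹) = x i - x j := by field_simp
  have h4 : 1 - x j * (x i)⁻¹ ≠ 0 := fun h => h2 (by rw [← h3, h, mul_zero])
  rw [← h3]
  field_simp

theorem ratioProd_mul (x : ι → F) {s : Finset ι} {i j : ι} (hj : j ∈ s.erase i) :
    ratioProd x i s * ratioProd x j (s.erase i) = (x i + x j) / (x i - x j) *
      ∏ k ∈ (s.erase i).erase j,
        ((x i + x k) / (x i - x k) * ((x j + x k) / (x j - x k))) := by
  rw [ratioProd, ratioProd, ← Finset.mul_prod_erase _ _ hj, Finset.prod_mul_distrib, mul_assoc]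

/-- The sum is geometric with ratio -z/y and telescopes after multiplication by y + z; r - 1 being
even fixes the last sign. -/
theorem alternating_sum {r : ℕ} (hr : Odd r) (y z : F) :
    (∑ a ∈ Finset.range (r - 1), (-1) ^ (a + 1) * (y ^ (r - 2 - a + 1) * z ^ (a + 1))) * (y + z) =
      y * z ^ r - y ^ r * z := by
  obtain ⟨m, rfl⟩ := hr
  have key : ∀ n ≤ 2 * m,
      (∑ a ∈ Finset.range n, (-1) ^ (a + 1) * (y ^ (2 * m + 1 - 2 - a + 1) * z ^ (a + 1))) *
        (y + z) = (-1) ^ n * (y ^ (2 * m + 1 - n) * z ^ (n + 1)) - y ^ (2 * m + 1) * z := by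
    intro n hn
    induction n with
    | zero => simp
    | succ n ih =>
      rw [Finset.sum_range_succ, add_mul, ih (by omega)]
      rw [show 2 * m + 1 - 2 - n + 1 = 2 * m - n by omega,
        show 2 * m + 1 - n = 2 * m - n + 1 by omega,
        show 2 * m + 1 - (n + 1) = 2 * m - n by omega]
      ring
  have := key (2 * m) le_rfl
  rw [pow_mul] at this
  simpa [mul_comm y] using this

variable [Algebra ℚ F]

theorem symSum_cons (u : ℚ[X]) (us : List ℚ[X]) (s : Finset ι) :
    symSum x (u :: us) s =
      ∑ i ∈ s, aeval (x i) u * ratioProd x i s * symSum x us (s.erase i) := rfl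

/-- Exchanging the first two variables changes only the sign of (x_i + x_j)/(x_i - x_j); all other
factors are symmetric. This antisymmetry is what the fermions encode. -/
theorem symSum_swap (x : ι → F) (u v : ℚ[X]) (us : List ℚ[X]) (s : Finset ι) :
    symSum x (u :: v :: us) s = -symSum x (v :: u :: us) s := by
  simp only [symSum_cons, Finset.mul_sum]
  rw [sum_erase_comm, ← Finset.sum_neg_distrib]
  refine Finset.sum_congr rfl fun i hi => ?_
  rw [← Finset.sum_neg_distrib]
  refine Finset.sum_congr rfl fun j hj => ?_
  have hj' : i ∈ s.erase j := by
    rw [Finset.mem_erase] at hj ⊢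
    exact ⟨hj.1.symm, hi⟩
  have h1 := ratioProd_mul x hj
  have h2 := ratioProd_mul x hj'
  rw [Finset.erase_right_comm] at h2
  have e : ∀ a b c d e : F, a * b * (c * d * e) = a * c * (b * d) * e := fun _ _ _ _ _ => by ring
  rw [e, e, h1, h2, Finset.erase_right_comm (a := j)]
  rw [← neg_sub (x i) (x j), div_neg, add_comm (x j)]
  simp only [mul_comm ((x j + _) / _)]
  ring

theorem symSum_cons_append (x : ι → F) (u : ℚ[X]) (us vs : List ℚ[X]) (s : Finset ι) :
    symSum x (u :: (us ++ vs)) s = (-1) ^ us.length * symSum x (us ++ u :: vs) s := by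
  induction us generalizing s with
  | nil => simp
  | cons v us ih =>
    rw [List.cons_append, symSum_swap, symSum_cons]
    simp only [ih]
    rw [List.cons_append, symSum_cons, List.length_cons, Finset.mul_sum, ← Finset.sum_neg_distrib]
    exact Finset.sum_congr rfl fun i _ => by ring

theorem symSum_eq_zero_of_mem (x : ι → F) {u : ℚ[X]} {us : List ℚ[X]} (h : u ∈ us)
    (s : Finset ι) : symSum x (u :: us) s = 0 := by
  have : CharZero F := algebraRat.charZero F
  induction us generalizing s with
  | nil => simp at h
  | cons v us ih =>
    by_cases huv : u = v
    · subst huv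
      exact self_eq_neg.1 (symSum_swap x u u us s)
    · rw [symSum_swap, symSum_cons, neg_eq_zero]
      exact Finset.sum_eq_zero fun i _ => by
        rw [ih ((List.mem_cons.1 h).resolve_left huv), mul_zero]

/-- The decreasing list of the elements of a finite set. -/
def descList (S : Finset ℕ) : List ℕ := S.sort (· ≥ ·)

theorem descList_eq {S : Finset ℕ} {l : List ℕ} (hl : l.Pairwise (· > ·)) (h : l.toFinset = S) :
    descList S = l := by
  subst h
  exact (List.toFinset_sort (· ≥ ·) (hl.imp fun h => (Nat.ne_of_gt h))).2 (hl.imp fun h => h.le)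

theorem descList_pairwise (S : Finset ℕ) : (descList S).Pairwise (· > ·) := by
  have h1 : (descList S).Pairwise (· ≥ ·) := Finset.pairwise_sort S (· ≥ ·)
  have h2 : (descList S).Nodup := Finset.sort_nodup S (· ≥ ·)
  exact (h1.and h2).imp fun h => lt_of_le_of_ne h.1 h.2.symm

theorem mem_descList {S : Finset ℕ} {k : ℕ} : k ∈ descList S ↔ k ∈ S := Finset.mem_sort (· ≥ ·)

theorem descList_split {S : Finset ℕ} {a : ℕ} (h : a ∉ S) :
    descList S = descList (S.filter (a < ·)) ++ descList (S.filter (· < a)) ∧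
    descList (insert a S) = descList (S.filter (a < ·)) ++ a :: descList (S.filter (· < a)) := by
  constructor
  · refine descList_eq ?_ ?_
    · rw [List.pairwise_append]
      refine ⟨descList_pairwise _, descList_pairwise _, fun b hb c hc => ?_⟩
      rw [mem_descList, Finset.mem_filter] at hb hc
      exact hc.2.trans hb.2
    · ext b
      simp only [List.mem_toFinset, List.mem_append, mem_descList, Finset.mem_filter]
      have : b ∈ S → b ≠ a := fun hb e => h (e ▸ hb)
      constructor
      · tauto
      · intro hb
        rcases lt_or_gt_of_ne (this hb) with h' | h' <;> tauto
  · refine descList_eq ?_ ?_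
    · rw [List.pairwise_append, List.pairwise_cons]
      refine ⟨descList_pairwise _, ⟨fun b hb => ?_, descList_pairwise _⟩, fun b hb c hc => ?_⟩
      · rw [mem_descList, Finset.mem_filter] at hb
        exact hb.2
      · rw [mem_descList, Finset.mem_filter] at hb
        rcases List.mem_cons.1 hc with rfl | hc
        · exact hb.2
        · rw [mem_descList, Finset.mem_filter] at hc
          exact hc.2.trans hb.2
    · ext b
      simp only [List.mem_toFinset, List.mem_append, List.mem_cons, mem_descList,
        Finset.mem_filter, Finset.mem_insert]
      constructor
      · tauto
      · rintro (rfl | hb)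
        · simp
        · rcases lt_trichotomy b a with h' | h' | h' <;> tauto

/-! ### Symmetrization as a map on the Fock space. -/

/-- The linear map that sends the basis vectors of the Fock space to the symmetrizations with
respect to `u`. -/
noncomputable def symMap (x : ι → F) (u : ℕ → ℚ[X]) (s : Finset ι) : Fock →ₗ[ℚ] F :=
  Fock.lift fun S => symSum x ((descList S).map u) s

theorem symMap_vec (x : ι → F) (u : ℕ → ℚ[X]) (s : Finset ι) (S : Finset ℕ) :
    symMap x u s (Fock.vec S) = symSum x ((descList S).map u) s := Fock.lift_vec _ _

theorem symMap_vac (x : ι → F) (u : ℕ → ℚ[X]) (s : Finset ι) : symMap x u s Fock.vac = 1 := by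
  rw [Fock.vac, symMap_vec, descList_eq (S := ∅) (l := []) List.Pairwise.nil rfl]
  rfl

/-- Creation of `a` is prepending `u a` to the list: sorting it into place produces `fockSign`, and
a repeated entry gives zero on both sides. -/
theorem symMap_create (x : ι → F) (u : ℕ → ℚ[X]) (s : Finset ι) (a : ℕ) (v : Fock) :
    symMap x u s (Fock.create a v) =
      ∑ i ∈ s, aeval (x i) (u a) * ratioProd x i s * symMap x u (s.erase i) v := by
  have : symMap x u s ∘ₗ Fock.create a =
      ∑ i ∈ s, (aeval (x i) (u a) * ratioProd x i s) • symMap x u (s.erase i) := by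
    refine Fock.hom_ext fun S => ?_
    simp only [LinearMap.comp_apply, LinearMap.sum_apply, LinearMap.smul_apply, symMap_vec,
      smul_eq_mul, Fock.create_vec]
    rw [← symSum_cons, ← List.map_cons (f := u)]
    split_ifs with h
    · rw [map_zero, List.map_cons,
        symSum_eq_zero_of_mem x (List.mem_map_of_mem (mem_descList.2 h))]
    · obtain ⟨h1, h2⟩ := descList_split h
      rw [map_smul, symMap_vec, h1, h2, List.map_cons, List.map_append, List.map_append,
        symSum_cons_append, List.map_cons, fockSign, List.length_map, descList, Finset.length_sort,
        Algebra.smul_def]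
      simp
  simpa using LinearMap.congr_fun this v

/-- The expansion of p_r into Schur P-functions of length one and two. By `alternating_sum` the
length-two terms collapse to (x_i x_j^r - x_i^r x_j)/(x_i - x_j) times a symmetric product, and by
`ratioProd_eq` they remove from the length-one term everything but x_i^r. -/
theorem sum_pow_eq_symMap (hx : IsGeneric x) {u : ℕ → ℚ[X]} {r : ℕ} (hr : Odd r)
    (hu : ∀ k < r, u k = X ^ (k + 1)) (s : Finset ι) :
    ∑ i ∈ s, x i ^ r = symMap x u s (Fock.mulP r Fock.vac) := by
  have hr0 := hr.pos
  rw [Fock.mulP_vac, map_add, map_sum, symMap_create, hu _ (by omega)]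
  have h1 : ∀ a ∈ Finset.range (r - 1), symMap x u s
      ((-1 : ℚ) ^ (a + 1) • Fock.create (r - 2 - a) (Fock.create a Fock.vac)) =
      ∑ i ∈ s, ∑ j ∈ s.erase i, ((-1) ^ (a + 1) * (x i ^ (r - 2 - a + 1) * x j ^ (a + 1))) *
        (ratioProd x i s * ratioProd x j (s.erase i)) := by
    intro a ha
    rw [Finset.mem_range] at ha
    rw [map_smul, symMap_create, hu _ (by omega), Algebra.smul_def, Finset.mul_sum]
    refine Finset.sum_congr rfl fun i _ => ?_
    rw [symMap_create, hu _ (by omega), Finset.mul_sum, Finset.mul_sum]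
    refine Finset.sum_congr rfl fun j _ => ?_
    simp only [symMap_vac, map_pow, map_neg, map_one, aeval_X]
    ring
  have hT : ∑ a ∈ Finset.range (r - 1), symMap x u s
      ((-1 : ℚ) ^ (a + 1) • Fock.create (r - 2 - a) (Fock.create a Fock.vac)) =
      ∑ i ∈ s, ∑ j ∈ s.erase i, (x i * x j ^ r - x i ^ r * x j) / (x i - x j) *
        ∏ k ∈ (s.erase i).erase j,
        ((x i + x k) / (x i - x k) * ((x j + x k) / (x j - x k))) := by
    rw [Finset.sum_congr rfl h1, Finset.sum_comm]
    refine Finset.sum_congr rfl fun i _ => ?_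
    rw [Finset.sum_comm]
    refine Finset.sum_congr rfl fun j hj => ?_
    rw [← Finset.sum_mul, ratioProd_mul x hj, ← alternating_sum hr]
    ring
  rw [hT]
  have hsplit : ∀ i j, (x i * x j ^ r - x i ^ r * x j) / (x i - x j) *
        ∏ k ∈ (s.erase i).erase j,
        ((x i + x k) / (x i - x k) * ((x j + x k) / (x j - x k))) =
      x i * x j ^ r / (x i - x j) * (∏ k ∈ (s.erase i).erase j,
        ((x i + x k) / (x i - x k) * ((x j + x k) / (x j - x k)))) -
      x i ^ r * x j / (x i - x j) * (∏ k ∈ (s.erase i).erase j,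
        ((x i + x k) / (x i - x k) * ((x j + x k) / (x j - x k)))) := fun i j => by ring
  simp only [hsplit, Finset.sum_sub_distrib]
  -- Exchanging the names i and j in the first part lets x_i^r be factored out of both.
  rw [sum_erase_comm s fun i j => x i * x j ^ r / (x i - x j) * (∏ k ∈ (s.erase i).erase j,
        ((x i + x k) / (x i - x k) * ((x j + x k) / (x j - x k)))), ← Finset.sum_sub_distrib,
        ← Finset.sum_add_distrib]
  refine Finset.sum_congr rfl fun i _ => ?_
  rw [ratioProd_eq hx s i, ← Finset.sum_sub_distrib]
  have : ∀ j ∈ s.erase i, x j * x i ^ r / (x j - x i) * (∏ k ∈ (s.erase j).erase i,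
        ((x j + x k) / (x j - x k) * ((x i + x k) / (x i - x k)))) -
      x i ^ r * x j / (x i - x j) * (∏ k ∈ (s.erase i).erase j,
        ((x i + x k) / (x i - x k) * ((x j + x k) / (x j - x k)))) =
      -(x i ^ r * 2) * (x j / (x i - x j) * (ratioProd x j (s.erase i) *
        ∏ k ∈ (s.erase i).erase j, (x i + x k) / (x i - x k))) := by
    intro j _
    rw [ratioProd, Finset.erase_right_comm (a := j), ← neg_sub (x i) (x j), div_neg]
    simp only [Finset.prod_mul_distrib]
    ring
  rw [Finset.sum_congr rfl this, ← Finset.mul_sum, symMap_vac]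
  simp only [map_pow, aeval_X]
  rw [Nat.sub_add_cancel hr0]
  ring

/-- Induction over creation operators: p_r on `s` is x_i^r plus p_r on `s.erase i`, and `hc` turns
x_i^r times `u a` into exactly the commutators of `mulP r` and `weightOp c` with `create a`.
Ordinary powers use c = 0 for every odd r; falling powers use r = 1. -/
theorem symMap_mulP (hx : IsGeneric x) {u : ℕ → ℚ[X]} {r : ℕ} (hr : Odd r)
    (hu : ∀ k < r, u k = X ^ (k + 1)) {c : ℕ → ℚ}
    (hc : ∀ k, X ^ r * u k = u (k + r) + C (c k) * u k) (s : Finset ι) (v : Fock) :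
    (∑ i ∈ s, x i ^ r) * symMap x u s v = symMap x u s (Fock.mulP r v + Fock.weightOp c v) := by
  have : ∀ (S : Finset ℕ) (s : Finset ι), (∑ i ∈ s, x i ^ r) * symMap x u s (Fock.vec S) =
      symMap x u s (Fock.mulP r (Fock.vec S) + Fock.weightOp c (Fock.vec S)) := by
    intro S
    induction S using Finset.induction_on with
    | empty =>
      intro s
      have : Fock.weightOp c (Fock.vec ∅) = 0 := by simp [Fock.weightOp, Fock.diag_vec]
      rw [this, add_zero, ← Fock.vac, ← sum_pow_eq_symMap hx hr hu, symMap_vac, mul_one]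
    | insert a S ha ih =>
      intro s
      have h1 := LinearMap.congr_fun (Fock.mulP_create r a) (Fock.vec S)
      have h2 := LinearMap.congr_fun (Fock.weightOp_create c a) (Fock.vec S)
      simp only [Module.End.mul_apply, LinearMap.add_apply, LinearMap.smul_apply] at h1 h2
      rw [Fock.vec_insert ha]
      simp only [map_smul, mul_smul_comm]
      rw [← smul_add, map_smul, h1, h2]
      congr 1
      simp only [map_add, map_smul, symMap_create, Finset.mul_sum]
      rw [Algebra.smul_def, Finset.mul_sum, ← Finset.sum_add_distrib, ← Finset.sum_add_distrib,
        ← Finset.sum_add_distrib]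
      refine Finset.sum_congr rfl fun i hi => ?_
      have h3 := ih (s.erase i)
      have h4 := congrArg (aeval (x i)) (hc a)
      rw [map_add] at h3
      simp only [map_mul, map_add, map_pow, aeval_X, aeval_C] at h4
      rw [← Finset.add_sum_erase s _ hi]
      linear_combination (aeval (x i) (u a) * ratioProd x i s) * h3 +
        (ratioProd x i s * symMap x u (s.erase i) (Fock.vec S)) * h4
  have h : (LinearMap.mulLeft ℚ (∑ i ∈ s, x i ^ r)) ∘ₗ symMap x u s =
      symMap x u s ∘ₗ (Fock.mulP r + Fock.weightOp c) :=
    Fock.hom_ext fun S => by simpa using this S s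
  simpa using LinearMap.congr_fun h v

end

/-! ### Polynomiality of the symmetrizations. -/

section

open Polynomial

/-- The elementary symmetric functions of `x` on `s`. -/
noncomputable def elem {ι R : Type} [CommRing R] (x : ι → R) (s : Finset ι) (m : ℕ) : R :=
  (elemPoly x s).coeff m

theorem elem_zero {ι R : Type} [CommRing R] (x : ι → R) (s : Finset ι) : elem x s 0 = 1 := by
  simp [elem, coeff_zero_eq_eval_zero, elemPoly, eval_prod]

theorem map_elem {ι R R' : Type} [CommRing R] [CommRing R'] (f : R →+* R') (x : ι → R)
    (s : Finset ι) (m : ℕ) : f (elem x s m) = elem (fun i => f (x i)) s m := by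
  rw [elem, elem, ← coeff_map]
  simp [elemPoly, Polynomial.map_prod]

variable {ι F : Type} [DecidableEq ι]

theorem elem_erase {R : Type} [CommRing R] (x : ι → R) {s : Finset ι} {i : ι} (hi : i ∈ s)
    (m : ℕ) : elem x (s.erase i) m = ∑ j ∈ Finset.range (m + 1), elem x s (m - j) * (-x i) ^ j := by
  induction m with
  | zero => simp [elem_zero]
  | succ m ih =>
    have : elem x s (m + 1) = elem x (s.erase i) (m + 1) + x i * elem x (s.erase i) m := by
      rw [elem, elemPoly_erase x hi, add_mul, one_mul, coeff_add, mul_assoc, coeff_C_mul,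
        coeff_X_mul]
      rfl
    rw [Finset.sum_range_succ', eq_sub_of_add_eq this.symm, ih, Finset.mul_sum]
    simp only [Nat.add_sub_add_right, pow_succ]
    rw [sub_eq_neg_add, ← Finset.sum_neg_distrib]
    congr 1
    · exact Finset.sum_congr rfl fun j _ => by ring
    · simp

/-- The coefficient of X^(k+1) in `partial_fractions`. -/
theorem sum_ratioProd_elem [Field F] {x : ι → F} (hx : IsGeneric x) (s : Finset ι) (k : ℕ) :
    2 * ∑ i ∈ s, x i * ratioProd x i s * elem x (s.erase i) k =
      (1 + (-1) ^ k) * elem x s (k + 1) := by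
  have h := congrArg (fun p => coeff p (k + 1)) (partial_fractions hx s)
  have h1 : (∏ j ∈ s, (1 - C (x j) * X)) = (elemPoly x s).comp (C (-1) * X) := by
    rw [elemPoly, prod_comp]
    refine Finset.prod_congr rfl fun j _ => ?_
    simp [sub_eq_add_neg]
  simp only [h1, comp_C_mul_X_coeff, coeff_sub, coeff_X_mul, finsetSum_coeff, coeff_C_mul] at h
  change elem x s (k + 1) * (-1) ^ (k + 1) = elem x s (k + 1) -
    ∑ i ∈ s, 2 * (x i * ratioProd x i s) * elem x (s.erase i) k at h
  rw [Finset.mul_sum]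
  have e : ∀ i ∈ s, 2 * (x i * ratioProd x i s * elem x (s.erase i) k) =
      2 * (x i * ratioProd x i s) * elem x (s.erase i) k := fun i _ => by ring
  rw [Finset.sum_congr rfl e]
  linear_combination h

/-- `Q` expresses the function `f` of a finite family of elements of a field through the
elementary symmetric functions of the family. -/
def Represents (Q : MvPolynomial ℕ ℚ)
    (f : ∀ (ι F : Type) [DecidableEq ι] [Field F] [Algebra ℚ F] (_ : ι → F) (_ : Finset ι), F) :
    Prop :=
  ∀ (ι F : Type) [DecidableEq ι] [Field F] [Algebra ℚ F] (x : ι → F) (s : Finset ι),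
    IsGeneric x → f ι F x s = MvPolynomial.aeval (elem x s) Q

/-- Expanding `elem x (s.erase i) k` in powers of x_i turns `sum_ratioProd_elem` into a triangular
recursion; the witness is this recursion solved for the sum with the highest power. -/
theorem exists_represents_power (k : ℕ) :
    ∃ Q, Represents Q fun _ _ _ _ _ x s => ∑ i ∈ s, x i ^ (k + 1) * ratioProd x i s := by
  induction k using Nat.strong_induction_on with
  | _ k ih =>
    choose Q hQ using ih
    refine ⟨MvPolynomial.C ((-1) ^ k) * (MvPolynomial.C ((1 + (-1) ^ k) / 2) * MvPolynomial.X (k + 1)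
      - ∑ j : Fin k, (-1) ^ (j : ℕ) * MvPolynomial.X (k - j) * Q j j.2), ?_⟩
    intro ι F _ _ _ x s hx
    have : CharZero F := algebraRat.charZero F
    have h := sum_ratioProd_elem hx s k
    have e : ∀ i ∈ s, x i * ratioProd x i s * elem x (s.erase i) k =
        ∑ j ∈ Finset.range (k + 1), (-1) ^ j * elem x s (k - j) * (x i ^ (j + 1) * ratioProd x i s) := by
      intro i hi
      rw [elem_erase x hi, Finset.mul_sum]
      refine Finset.sum_congr rfl fun j _ => ?_
      rw [neg_pow]
      ring
    rw [Finset.sum_congr rfl e, Finset.sum_comm] at h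
    simp only [← Finset.mul_sum] at h
    rw [Finset.sum_range_succ, Nat.sub_self, elem_zero, mul_one, Finset.sum_range] at h
    have e2 : ∀ j : Fin k, ∑ i ∈ s, x i ^ ((j : ℕ) + 1) * ratioProd x i s =
      MvPolynomial.aeval (elem x s) (Q j j.2) := fun j => hQ j j.2 ι F x s hx
    simp only [e2] at h
    simp only [map_mul, map_sub, map_sum, map_pow, map_neg, map_one, MvPolynomial.aeval_C,
      MvPolynomial.aeval_X, map_div₀, map_add, map_ofNat]
    have hs : ((-1 : F) ^ k) * (-1) ^ k = 1 := by rw [← mul_pow]; simp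
    generalize (∑ i ∈ s, x i ^ (k + 1) * ratioProd x i s) = A at h ⊢
    generalize (∑ j : Fin k, (-1) ^ (j : ℕ) * elem x s (k - j) *
      (MvPolynomial.aeval (elem x s)) (Q j j.2)) = D at h ⊢
    linear_combination (1 / 2 * (-1) ^ k) * h - A * hs

/-- Passing from the elementary symmetric functions of a family to those of the family with one
member removed. -/
noncomputable def removeOne : MvPolynomial ℕ ℚ →ₐ[ℚ] (MvPolynomial ℕ ℚ)[X] :=
  MvPolynomial.aeval fun m => ∑ j ∈ Finset.range (m + 1), C (MvPolynomial.X (m - j)) * (-X) ^ j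

theorem eval₂_removeOne [Field F] [Algebra ℚ F] (x : ι → F) {s : Finset ι} {i : ι} (hi : i ∈ s)
    (Q : MvPolynomial ℕ ℚ) :
    (removeOne Q).eval₂ (MvPolynomial.aeval (elem x s) : MvPolynomial ℕ ℚ →ₐ[ℚ] F).toRingHom (x i) =
      MvPolynomial.aeval (elem x (s.erase i)) Q := by
  induction Q using MvPolynomial.induction_on with
  | C a => simp [removeOne, IsScalarTower.algebraMap_apply ℚ (MvPolynomial ℕ ℚ) (MvPolynomial ℕ ℚ)[X]]
  | add p q hp hq => rw [map_add, eval₂_add, hp, hq, map_add]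
  | mul_X p m hp =>
    rw [map_mul, eval₂_mul, hp, map_mul, MvPolynomial.aeval_X, elem_erase x hi]
    congr 1
    simp [removeOne, eval₂_finsetSum, eval₂_mul, eval₂_pow, eval₂_neg]

/-- Sum over the first variable last: `removeOne` writes the inner symmetrization as a polynomial in
x_i, and power by power `exists_represents_power` applies. The vanishing at 0 is essential, since ∑
`ratioProd` without a power of x_i depends on the parity of the number of variables. -/
theorem exists_represents_symSum (us : List ℚ[X]) (hus : ∀ u ∈ us, u.eval 0 = 0) :
    ∃ Q, Represents Q fun _ _ _ _ _ x s => symSum x us s := by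
  induction us with
  | nil => exact ⟨1, fun ι F _ _ _ x s _ => by simp [symSum]⟩
  | cons u us ih =>
    obtain ⟨Q, hQ⟩ := ih fun v hv => hus v (List.mem_cons_of_mem _ hv)
    choose g hg using exists_represents_power
    obtain ⟨v, rfl⟩ : X ∣ u := by
      rw [X_dvd_iff, coeff_zero_eq_eval_zero]
      exact hus u (by simp)
    set W : (MvPolynomial ℕ ℚ)[X] := v.map (algebraMap ℚ (MvPolynomial ℕ ℚ)) * removeOne Q with hW
    refine ⟨W.sum fun k a => a * g k, ?_⟩
    intro ι F _ _ _ x s hx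
    set φ : MvPolynomial ℕ ℚ →ₐ[ℚ] F := MvPolynomial.aeval (elem x s) with hφ
    have e : ∀ i ∈ s, aeval (x i) (X * v) * ratioProd x i s * symSum x us (s.erase i) =
        W.sum fun k a => φ a * (x i ^ (k + 1) * ratioProd x i s) := by
      intro i hi
      rw [show symSum x us (s.erase i) = _ from hQ ι F x (s.erase i) hx, ← eval₂_removeOne x hi]
      have : W.eval₂ φ.toRingHom (x i) = aeval (x i) v *
          (removeOne Q).eval₂ φ.toRingHom (x i) := by
        rw [hW, eval₂_mul, eval₂_map, aeval_def]
        congr 2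
        exact RingHom.ext fun a => by simp
      rw [map_mul, aeval_X, mul_assoc, mul_comm (ratioProd x i s), mul_assoc, ← mul_assoc (aeval _ v),
        ← this, eval₂_eq_sum, Polynomial.sum, Polynomial.sum, Finset.sum_mul, Finset.mul_sum]
      refine Finset.sum_congr rfl fun k _ => ?_
      simp only [AlgHom.toRingHom_eq_coe, RingHom.coe_coe]
      ring
    change symSum x (X * v :: us) s = φ _
    rw [symSum_cons, Finset.sum_congr rfl e]
    simp only [Polynomial.sum]
    rw [Finset.sum_comm, map_sum]
    refine Finset.sum_congr rfl fun k _ => ?_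
    rw [← Finset.mul_sum, map_mul, ← hg k ι F x s hx]

/-! ### Comparison with the sum over permutations. -/

theorem ratioProd_map {κ : Type} [DecidableEq κ] [Field F] (x : ι → F) (f : κ ↪ ι) (s : Finset κ)
    (i : κ) : ratioProd x (f i) (s.map f) = ratioProd (x ∘ f) i s := by
  rw [ratioProd, ← Finset.map_erase, Finset.prod_map]
  rfl

theorem symSum_map {κ : Type} [DecidableEq κ] [Field F] [Algebra ℚ F] (x : ι → F) (f : κ ↪ ι)
    (us : List ℚ[X]) (s : Finset κ) : symSum x us (s.map f) = symSum (x ∘ f) us s := by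
  induction us generalizing s with
  | nil => rfl
  | cons u us ih =>
    rw [symSum_cons, Finset.sum_map, symSum_cons]
    refine Finset.sum_congr rfl fun i _ => ?_
    rw [ratioProd_map, ← Finset.map_erase, ih]
    rfl

/-- Permutations are grouped by the image p of the first index. Those of the variables left over at
the end leave the summand unchanged, which accounts for the factorial. -/
theorem sum_perm_eq_symSum [Field F] [Algebra ℚ F] {N : ℕ} (x : Fin N → F) (us : List ℚ[X])
    (h : us.length ≤ N) :
    ∑ ω : Equiv.Perm (Fin N), ∏ i ∈ Finset.univ.filter (fun i : Fin N => (i : ℕ) < us.length),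
      (aeval (x (ω i)) (us.getD i 0) *
        ∏ j ∈ Finset.Ioi i, (x (ω i) + x (ω j)) / (x (ω i) - x (ω j))) =
      ((N - us.length).factorial : F) * symSum x us Finset.univ := by
  induction us generalizing N with
  | nil => simp [symSum, Fintype.card_perm]
  | cons u us ih =>
    obtain _ | n := N
    · simp at h
    rw [List.length_cons, Nat.add_le_add_iff_right] at h
    rw [← Equiv.sum_comp Equiv.Perm.decomposeFin.symm, Fintype.sum_prod_type, symSum_cons,
      Finset.mul_sum]
    refine Finset.sum_congr rfl fun p _ => ?_
    -- Enumerates the indices other than p in the order used by `decomposeFin`.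
    let f : Fin n ↪ Fin (n + 1) :=
      ⟨fun j => Equiv.swap 0 p j.succ, (Equiv.injective _).comp (Fin.succ_injective n)⟩
    have hf : Finset.univ.erase p = Finset.univ.map f := by
      ext q
      simp only [Finset.mem_erase, Finset.mem_univ, and_true, Finset.mem_map, true_and]
      constructor
      · intro hq
        have : Equiv.swap 0 p q ≠ 0 := fun h => hq (by
          rw [← Equiv.swap_apply_self 0 p q] at *
          simp at h
          simp [h])
        obtain ⟨j, hj⟩ := Fin.exists_succ_eq.2 this
        exact ⟨j, by change Equiv.swap 0 p j.succ = q; rw [hj, Equiv.swap_apply_self]⟩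
      · rintro ⟨j, rfl⟩ hj
        have : Equiv.swap 0 p j.succ = Equiv.swap 0 p 0 := by
          rw [Equiv.swap_apply_left]; exact hj
        exact Fin.succ_ne_zero j ((Equiv.injective _) this)
    have hr : ∀ e : Equiv.Perm (Fin n), ∏ j : Fin n, (x p + x (f (e j))) / (x p - x (f (e j))) =
        ratioProd x p Finset.univ := by
      intro e
      rw [ratioProd, hf, Finset.prod_map]
      exact Equiv.prod_comp e fun j => (x p + x (f j)) / (x p - x (f j))
    have key : ∀ e : Equiv.Perm (Fin n),
        ∏ i ∈ Finset.univ.filter (fun i : Fin (n + 1) => (i : ℕ) < (u :: us).length),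
          (aeval (x (Equiv.Perm.decomposeFin.symm (p, e) i)) ((u :: us).getD i 0) *
            ∏ j ∈ Finset.Ioi i,
              (x (Equiv.Perm.decomposeFin.symm (p, e) i) +
                x (Equiv.Perm.decomposeFin.symm (p, e) j)) /
              (x (Equiv.Perm.decomposeFin.symm (p, e) i) -
                x (Equiv.Perm.decomposeFin.symm (p, e) j))) =
        aeval (x p) u * ratioProd x p Finset.univ *
          ∏ i ∈ Finset.univ.filter (fun i : Fin n => (i : ℕ) < us.length),
          (aeval ((x ∘ f) (e i)) (us.getD i 0) * ∏ j ∈ Finset.Ioi i,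
            ((x ∘ f) (e i) + (x ∘ f) (e j)) / ((x ∘ f) (e i) - (x ∘ f) (e j))) := by
      intro e
      rw [Finset.prod_filter, Fin.prod_univ_succ, Finset.prod_filter, ← hr e]
      congr 1
      · simp [f]
      · refine Finset.prod_congr rfl fun i _ => ?_
        simp [Fin.prod_Ioi_succ, f]
    rw [Finset.sum_congr rfl fun e _ => key e, ← Finset.mul_sum, ih (x ∘ f) h, hf, symSum_map,
      List.length_cons, Nat.add_sub_add_right]
    ring

end

namespace PolySeq

open Polynomial

theorem toPolynomial_algebraMap {N : ℕ} (f : MvPolynomial (Fin N) ℚ) :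
    toPolynomial (algebraMap (MvPolynomial (Fin N) ℚ) (RatFun N) f) = f := by
  have h : ∃ g, algebraMap (MvPolynomial (Fin N) ℚ) (RatFun N) g = algebraMap _ _ f := ⟨f, rfl⟩
  rw [toPolynomial, dif_pos h]
  exact IsFractionRing.injective _ (RatFun N) h.choose_spec

theorem isGeneric_ratVar (N : ℕ) : IsGeneric (ratVar : Fin N → RatFun N) := by
  have hinj := IsFractionRing.injective (MvPolynomial (Fin N) ℚ) (RatFun N)
  constructor
  · intro i j hij h
    rw [ratVar, ratVar, ← map_sub, map_eq_zero_iff _ hinj, sub_eq_zero] at h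
    exact hij (MvPolynomial.X_injective h)
  · intro i j h
    rw [ratVar, ratVar, ← map_add, map_eq_zero_iff _ hinj] at h
    have := congrArg (MvPolynomial.eval fun _ => (1 : ℚ)) h
    norm_num at this

theorem symSum_eq_zero_of_card_lt {ι F : Type} [DecidableEq ι] [Field F] [Algebra ℚ F] (x : ι → F)
    (us : List ℚ[X]) (s : Finset ι) (h : s.card < us.length) : symSum x us s = 0 := by
  induction us generalizing s with
  | nil => simp at h
  | cons u us ih =>
    rw [symSum_cons]
    refine Finset.sum_eq_zero fun i hi => ?_
    rw [ih, mul_zero]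
    rw [Finset.card_erase_of_mem hi]
    have := Finset.card_pos.2 ⟨i, hi⟩
    rw [List.length_cons] at h
    omega

theorem symmetrization_eq_symSum (lam : StrictPartition) (N : ℕ)
    (pw : RatFun N → ℕ → RatFun N) (w : ℕ → ℚ[X]) (h : ∀ x k, pw x k = aeval x (w k)) :
    symmetrization lam N pw = symSum ratVar (lam.1.parts.map w) Finset.univ := by
  rw [symmetrization]
  have : CharZero (RatFun N) := algebraRat.charZero _
  split_ifs with hl
  · have hlen : (lam.1.parts.map w).length = lam.1.length := List.length_map _
    have e := sum_perm_eq_symSum (ratVar : Fin N → RatFun N) (lam.1.parts.map w) (hlen.trans_le hl)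
    rw [hlen] at e
    rw [inv_mul_eq_iff_eq_mul₀ (Nat.cast_ne_zero.2 (Nat.factorial_ne_zero _)), ← e]
    refine Finset.sum_congr rfl fun ω _ => Finset.prod_congr rfl fun i hi => ?_
    rw [Finset.mem_filter] at hi
    have hi' : (i : ℕ) < lam.1.parts.length := hi.2
    rw [h, IntPartition.part, Nat.add_sub_cancel]
    simp [hi']
  · rw [symSum_eq_zero_of_card_lt]
    rw [List.length_map, Finset.card_univ, Fintype.card_fin]
    exact not_le.1 hl

/-- A single polynomial in the elementary symmetric polynomials gives the symmetrizations of the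
list `us` in every number of variables. -/
theorem exists_represents_toPolynomial (us : List ℚ[X]) (hus : ∀ u ∈ us, u.eval 0 = 0) :
    ∃ Q, (Represents Q fun _ _ _ _ _ x s => symSum x us s) ∧
      ∀ N, toPolynomial (symSum (ratVar : Fin N → RatFun N) us Finset.univ) =
        MvPolynomial.aeval (elem (MvPolynomial.X : Fin N → MvPolynomial (Fin N) ℚ) Finset.univ) Q := by
  obtain ⟨Q, hQ⟩ := exists_represents_symSum us hus
  refine ⟨Q, hQ, fun N => ?_⟩
  rw [show symSum ratVar us Finset.univ = _ from hQ _ _ _ _ (isGeneric_ratVar N), ← toPolynomial_algebraMap (MvPolynomial.aeval _ Q)]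
  congr 1
  rw [← MvPolynomial.aeval_algebraMap_apply]
  congr 2
  ext m
  exact (map_elem (algebraMap (MvPolynomial (Fin N) ℚ) (RatFun N)) _ _ _).symm

/-- Polynomiality guarantees that the default value in `toPolynomial` is not used here. -/
theorem algebraMap_toPolynomial_symSum (us : List ℚ[X]) (hus : ∀ u ∈ us, u.eval 0 = 0) (N : ℕ) :
    algebraMap (MvPolynomial (Fin N) ℚ) (RatFun N)
      (toPolynomial (symSum (ratVar : Fin N → RatFun N) us Finset.univ)) =
      symSum ratVar us Finset.univ := by
  obtain ⟨Q, hQ, h⟩ := exists_represents_toPolynomial us hus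
  rw [h, show symSum ratVar us Finset.univ = _ from hQ _ _ _ _ (isGeneric_ratVar N), ← MvPolynomial.aeval_algebraMap_apply]
  congr 2
  ext m
  exact map_elem (algebraMap (MvPolynomial (Fin N) ℚ) (RatFun N)) _ _ _

/-- Evaluation commutes with the symmetrization despite the denominators, as one and the same `Q`
represents it over the rational functions and over ℚ. -/
theorem eval_toPolynomial_symSum (us : List ℚ[X]) (hus : ∀ u ∈ us, u.eval 0 = 0) {N : ℕ}
    {x : Fin N → ℚ} (hx : IsGeneric x) :
    MvPolynomial.eval x (toPolynomial (symSum (ratVar : Fin N → RatFun N) us Finset.univ)) =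
      symSum x us Finset.univ := by
  obtain ⟨Q, hQ, h⟩ := exists_represents_toPolynomial us hus
  rw [h, show symSum x us Finset.univ = _ from hQ _ _ _ _ hx, ← MvPolynomial.coe_aeval_eq_eval, RingHom.coe_coe,
    ← AlgHom.comp_apply, MvPolynomial.comp_aeval]
  congr 2
  ext m
  have := map_elem (MvPolynomial.aeval x : MvPolynomial (Fin N) ℚ →ₐ[ℚ] ℚ).toRingHom
    MvPolynomial.X Finset.univ m
  simpa using this

end PolySeq

/-! ### Strict partitions as finite sets. -/

namespace StrictPartition

/-- The strict partition with parts `k + 1`, `k ∈ S`. -/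
noncomputable def ofSet (S : Finset ℕ) : StrictPartition :=
  ⟨⟨(descList S).map (· + 1), by
      rw [List.pairwise_map]
      exact (descList_pairwise S).imp fun h => Nat.succ_le_succ h.le, by simp⟩, by
    rw [IntPartition.IsStrict, List.Nodup, List.pairwise_map]
    exact (descList_pairwise S).imp fun h => by omega⟩

/-- The set of the `k` such that `k + 1` is a part. -/
def toSet (lam : StrictPartition) : Finset ℕ := (lam.1.parts.map (· - 1)).toFinset

theorem parts_ofSet (S : Finset ℕ) : (ofSet S).1.parts = (descList S).map (· + 1) := rfl

theorem pairwise_parts (lam : StrictPartition) : lam.1.parts.Pairwise (· > ·) :=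
  (lam.1.sorted.and lam.2).imp fun h => lt_of_le_of_ne h.1 h.2.symm

theorem toSet_ofSet (S : Finset ℕ) : (ofSet S).toSet = S := by
  rw [toSet, parts_ofSet, List.map_map]
  ext k
  simp [mem_descList]

theorem descList_toSet (lam : StrictPartition) : descList lam.toSet = lam.1.parts.map (· - 1) := by
  refine descList_eq ?_ rfl
  rw [List.pairwise_map]
  refine List.Pairwise.imp_of_mem ?_ (pairwise_parts lam)
  intro a b _ hb hab
  have := lam.1.pos b hb
  omega

theorem ofSet_toSet (lam : StrictPartition) : ofSet lam.toSet = lam := by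
  refine Subtype.ext (IntPartition.ext ?_)
  rw [parts_ofSet, descList_toSet, List.map_map]
  conv_rhs => rw [← List.map_id lam.1.parts]
  refine List.map_congr_left fun a ha => ?_
  have := lam.1.pos a ha
  simp only [Function.comp_apply, id_eq]
  omega

theorem length_descList (S : Finset ℕ) : (descList S).length = S.card := Finset.length_sort _

theorem length_ofSet (S : Finset ℕ) : (ofSet S).1.length = S.card := by
  rw [IntPartition.length, parts_ofSet, List.length_map, length_descList]

theorem sum_map_descList (S : Finset ℕ) (f : ℕ → ℕ) : ((descList S).map f).sum = ∑ k ∈ S, f k := by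
  have h : (descList S).toFinset = S := Finset.sort_toFinset S (· ≥ ·)
  have h2 : (descList S).Nodup := Finset.sort_nodup S (· ≥ ·)
  conv_rhs => rw [← h]
  rw [List.sum_toFinset _ h2]

theorem size_ofSet (S : Finset ℕ) : (ofSet S).1.size = ∑ k ∈ S, (k + 1) := by
  rw [IntPartition.size, parts_ofSet, sum_map_descList]

end StrictPartition

/-! ### Schur P-functions as images of the Fock basis. -/

namespace PolySeq

open Polynomial StrictPartition

/-- The polynomials `x (x - 1) ⋯ (x - k)`. -/
noncomputable def fallingPoly (k : ℕ) : ℚ[X] := ∏ m ∈ Finset.range (k + 1), (X - C (m : ℚ))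

theorem schurP_ofSet (S : Finset ℕ) (N : ℕ) :
    schurP (ofSet S) N = toPolynomial
      (symSum ratVar ((descList S).map fun k => (X ^ (k + 1) : ℚ[X])) Finset.univ) := by
  rw [schurP, symmetrization_eq_symSum _ _ _ (fun k => X ^ k) (by simp), parts_ofSet, List.map_map]
  rfl

theorem factorialSchurP_ofSet (S : Finset ℕ) (N : ℕ) :
    factorialSchurP (ofSet S) N = toPolynomial
      (symSum ratVar ((descList S).map fallingPoly) Finset.univ) := by
  rw [factorialSchurP, symmetrization_eq_symSum _ _ _
    (fun k => ∏ m ∈ Finset.range k, (X - C (m : ℚ))) (by simp), parts_ofSet, List.map_map]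
  rfl

/-- The linear map that sends the basis vectors of the Fock space to the Schur `P`-functions. -/
noncomputable def schurMap : Fock →ₗ[ℚ] PolySeq := Fock.lift fun S => schurP (ofSet S)

/-- The linear map that sends the basis vectors of the Fock space to the factorial Schur
`P`-functions. -/
noncomputable def factorialMap : Fock →ₗ[ℚ] PolySeq := Fock.lift fun S => factorialSchurP (ofSet S)

theorem _root_.Fock.map_eq_of_vec {R F : Type} [CommRing R] [Algebra ℚ R] [Field F] [Algebra ℚ F]
    (φ : R →+* F) (A : Fock →ₗ[ℚ] R) (B : Fock →ₗ[ℚ] F)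
    (h : ∀ S, φ (A (Fock.vec S)) = B (Fock.vec S)) (v : Fock) : φ (A v) = B v := by
  have : φ.toRatAlgHom.toLinearMap ∘ₗ A = B := Fock.hom_ext fun S => h S
  exact LinearMap.congr_fun this v

theorem algebraMap_schurMap (N : ℕ) (v : Fock) :
    algebraMap (MvPolynomial (Fin N) ℚ) (RatFun N) (schurMap v N) =
      symMap ratVar (fun k => X ^ (k + 1)) Finset.univ v := by
  refine Fock.map_eq_of_vec (algebraMap (MvPolynomial (Fin N) ℚ) (RatFun N))
    (LinearMap.proj N ∘ₗ schurMap) (symMap ratVar (fun k => X ^ (k + 1)) Finset.univ) ?_ v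
  intro S
  simp only [LinearMap.comp_apply, LinearMap.proj_apply, schurMap, Fock.lift_vec, symMap_vec,
    schurP_ofSet]
  refine algebraMap_toPolynomial_symSum _ (fun u hu => ?_) N
  obtain ⟨k, _, rfl⟩ := List.mem_map.1 hu
  simp

theorem powerSum_mul_schurMap {r : ℕ} (hr : Odd r) (v : Fock) :
    powerSum r * schurMap v = schurMap (Fock.mulP r v) := by
  funext N
  apply IsFractionRing.injective _ (RatFun N)
  rw [Pi.mul_apply, map_mul, algebraMap_schurMap, algebraMap_schurMap]
  have h := symMap_mulP (isGeneric_ratVar N) (u := fun k => X ^ (k + 1)) hr (fun _ _ => rfl)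
    (c := fun _ => 0) (fun k => by simp [← pow_add]; ring) Finset.univ v
  have h0 : Fock.weightOp (fun _ => 0) v = 0 := by
    have : Fock.weightOp (fun _ => 0) = 0 := Fock.hom_ext fun S => by
      simp [Fock.weightOp, Fock.diag_vec]
    rw [this, LinearMap.zero_apply]
  rw [h0, add_zero] at h
  rw [← h, powerSum, MvPolynomial.psum, map_sum]
  simp [ratVar]

theorem powerSumPartition_eq {ρ : IntPartition} (hρ : ρ.IsOdd) :
    powerSumPartition ρ = schurMap (Fock.powerVec ρ.parts) := by
  have : ∀ l : List ℕ, (∀ r ∈ l, Odd r) → (l.map powerSum).prod = schurMap (Fock.powerVec l) := by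
    intro l hl
    induction l with
    | nil =>
      funext N
      apply IsFractionRing.injective _ (RatFun N)
      rw [algebraMap_schurMap, Fock.powerVec, symMap_vac]
      simp
    | cons r l ih =>
      rw [List.map_cons, List.prod_cons, ih fun s hs => hl s (List.mem_cons_of_mem _ hs),
        powerSum_mul_schurMap (hl r (by simp)), Fock.powerVec]
  exact this _ hρ

/-! ### Linear independence of the Schur P-functions; the map Ψ. -/

/-- The alternants in `N` variables. -/
noncomputable def alternant (N : ℕ) : Fock →ₗ[ℚ] MvPolynomial (Fin N) ℚ :=
  Fock.lift fun T => if T.card = N then ∑ ω : Equiv.Perm (Fin N), (Equiv.Perm.sign ω : ℤ) •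
    MvPolynomial.monomial
      (∑ i : Fin N, Finsupp.single (ω i) ((descList T).getD i 0 + 1)) (1 : ℚ) else 0

/-- With as many parts as variables, the full product of the (x_i + x_j)/(x_i - x_j) is
antisymmetric and factors out, leaving an alternating sum of monomials. With more parts both sides
are zero. -/
theorem symMap_vec_eq_alternant {F : Type} [Field F] [Algebra ℚ F] (N : ℕ)
    (φ : MvPolynomial (Fin N) ℚ →+* F) {T : Finset ℕ} (hT : N ≤ T.card) :
    symMap (fun i => φ (MvPolynomial.X i)) (fun k => X ^ (k + 1)) Finset.univ (Fock.vec T) =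
      (∏ i : Fin N, ∏ j ∈ Finset.Ioi i, (φ (MvPolynomial.X i) + φ (MvPolynomial.X j)) /
        (φ (MvPolynomial.X i) - φ (MvPolynomial.X j))) * φ (alternant N (Fock.vec T)) := by
  set x := fun i => φ (MvPolynomial.X i) with hx
  rw [symMap_vec, alternant, Fock.lift_vec]
  set us := (descList T).map fun k => (X ^ (k + 1) : ℚ[X]) with hus
  have hlen : us.length = T.card := by rw [hus, List.length_map, length_descList]
  rcases hT.lt_or_eq with h | h
  · rw [if_neg h.ne', map_zero, mul_zero, symSum_eq_zero_of_card_lt]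
    rwa [hlen, Finset.card_univ, Fintype.card_fin]
  · have e := sum_perm_eq_symSum x us (hlen.trans h.symm).le
    rw [hlen, ← h, Nat.sub_self, Nat.factorial_zero, Nat.cast_one, one_mul] at e
    rw [if_pos h.symm, ← e, map_sum, Finset.mul_sum]
    refine Finset.sum_congr rfl fun ω _ => ?_
    rw [Finset.filter_true_of_mem fun i _ => i.2, Finset.prod_mul_distrib,
      Equiv.Perm.prod_Ioi_comp_eq_sign_mul_prod (f := fun i j => (x i + x j) / (x i - x j))
        ω (fun i j => by rw [← neg_sub (x j), div_neg, add_comm])]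
    rw [map_zsmul, zsmul_eq_mul]
    have : φ (MvPolynomial.monomial
      (∑ i : Fin N, Finsupp.single (ω i) ((descList T).getD i 0 + 1)) (1 : ℚ)) =
        ∏ i : Fin N, aeval (x (ω i)) (us.getD i 0) := by
      rw [MvPolynomial.monomial_sum_one, map_prod]
      refine Finset.prod_congr rfl fun i _ => ?_
      have hi : (i : ℕ) < (descList T).length := by rw [length_descList, ← h]; exact i.2
      rw [← MvPolynomial.X_pow_eq_monomial, map_pow, hus]
      simp only [List.getD_eq_getElem?_getD, List.getElem?_map, List.getElem?_eq_getElem hi,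
        Option.map_some, Option.getD_some]
      simp [hx]
    rw [this]
    ring

theorem symMap_eq_alternant {F : Type} [Field F] [Algebra ℚ F] (N : ℕ)
    (φ : MvPolynomial (Fin N) ℚ →+* F) {v : Fock}
    (hv : Fock.diag (fun T => if T.card < N then 0 else 1) v = v) :
    symMap (fun i => φ (MvPolynomial.X i)) (fun k => X ^ (k + 1)) Finset.univ v =
      (∏ i : Fin N, ∏ j ∈ Finset.Ioi i, (φ (MvPolynomial.X i) + φ (MvPolynomial.X j)) /
        (φ (MvPolynomial.X i) - φ (MvPolynomial.X j))) * φ (alternant N v) := by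
  set P := Fock.diag (fun T => if T.card < N then 0 else 1) with hP
  have hcomp : symMap (fun i => φ (MvPolynomial.X i)) (fun k => X ^ (k + 1)) Finset.univ ∘ₗ P =
      LinearMap.mulLeft ℚ (∏ i : Fin N, ∏ j ∈ Finset.Ioi i,
        (φ (MvPolynomial.X i) + φ (MvPolynomial.X j)) /
          (φ (MvPolynomial.X i) - φ (MvPolynomial.X j))) ∘ₗ
        φ.toRatAlgHom.toLinearMap ∘ₗ alternant N ∘ₗ P := by
    refine Fock.hom_ext fun T => ?_
    simp only [LinearMap.comp_apply, hP, Fock.diag_vec]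
    split_ifs with h
    · simp
    · rw [one_smul]
      exact symMap_vec_eq_alternant N φ (not_lt.1 h)
  have := LinearMap.congr_fun hcomp v
  simp only [LinearMap.comp_apply, hv] at this
  exact this

/-- Equality of exponent vectors forces the same set of entries, and these being distinct, the
trivial permutation. -/
theorem coeff_alternant (S T : Finset ℕ) :
    MvPolynomial.coeff (∑ i : Fin S.card, Finsupp.single i ((descList S).getD i 0 + 1))
      (alternant S.card (Fock.vec T)) = if T = S then 1 else 0 := by
  have hval : ∀ (ω : Equiv.Perm (Fin S.card)) (U : Finset ℕ) (i : Fin S.card),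
      (∑ i : Fin S.card, Finsupp.single (ω i) ((descList U).getD i 0 + 1)) (ω i) =
        (descList U).getD i 0 + 1 := by
    intro ω U i
    rw [Finsupp.finsetSum_apply, Finset.sum_eq_single i]
    · simp
    · intro j _ hj
      simp [hj]
    · simp
  have key : ∀ ω : Equiv.Perm (Fin S.card), T.card = S.card →
      (∑ i : Fin S.card, Finsupp.single (ω i) ((descList T).getD i 0 + 1) =
        ∑ i : Fin S.card, Finsupp.single i ((descList S).getD i 0 + 1)) → T = S ∧ ω = 1 := by
    intro ω hc h
    have h1 : ∀ i : Fin S.card, (descList T).getD i 0 = (descList S).getD (ω i) 0 := by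
      intro i
      have := DFunLike.congr_fun h (ω i)
      rw [hval ω T i] at this
      have h2 := hval 1 S (ω i)
      simp only [Equiv.Perm.coe_one, id_eq] at h2
      rw [h2] at this
      omega
    have hTS : T = S := by
      refine Finset.eq_of_subset_of_card_le (fun k hk => ?_) hc.ge
      rw [← mem_descList, List.mem_iff_getElem] at hk ⊢
      obtain ⟨i, hi, rfl⟩ := hk
      have hi' : i < S.card := by rwa [length_descList, hc] at hi
      refine ⟨ω ⟨i, hi'⟩, by rw [length_descList]; exact (ω _).2, ?_⟩
      have := h1 ⟨i, hi'⟩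
      rw [List.getD_eq_getElem _ _ hi, List.getD_eq_getElem] at this
      exact this.symm
    subst hTS
    refine ⟨rfl, Equiv.ext fun i => ?_⟩
    have h2 := h1 i
    have hn : (descList T).Nodup := Finset.sort_nodup T (· ≥ ·)
    have hl : ∀ j : Fin T.card, (j : ℕ) < (descList T).length := fun j => by
      rw [length_descList]; exact j.2
    rw [List.getD_eq_getElem _ _ (hl _), List.getD_eq_getElem _ _ (hl _),
      hn.getElem_inj_iff] at h2
    exact (Fin.ext h2).symm
  rw [alternant, Fock.lift_vec]
  by_cases hc : T.card = S.card
  · rw [if_pos hc, MvPolynomial.coeff_sum]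
    simp only [MvPolynomial.coeff_smul, MvPolynomial.coeff_monomial]
    split_ifs with hTS
    · subst hTS
      rw [Finset.sum_eq_single 1]
      · simp
      · intro ω _ hω
        rw [if_neg fun h => hω (key ω rfl h).2, smul_zero]
      · simp
    · exact Finset.sum_eq_zero fun ω _ => by rw [if_neg fun h => hTS (key ω hc h).1, smul_zero]
  · rw [if_neg hc, if_neg fun h => hc (by rw [h]), MvPolynomial.coeff_zero]

theorem coeff_diag (f : Finset ℕ → ℚ) (S : Finset ℕ) (v : Fock) :
    Fock.coeff S (Fock.diag f v) = f S * Fock.coeff S v := by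
  have : Fock.coeff S ∘ₗ Fock.diag f = f S • Fock.coeff S := Fock.hom_ext fun T => by
    rw [LinearMap.comp_apply, Fock.diag_vec, map_smul, LinearMap.smul_apply, Fock.coeff_vec]
    split_ifs with h
    · rw [h]
    · simp
  exact LinearMap.congr_fun this v

/-- Induction on the number of parts. Once the coefficients of shorter partitions vanish, pass to
`S.card` variables: longer ones disappear, and those of this length become a common nonzero factor
times independent alternants. -/
theorem schurMap_injective : Function.Injective schurMap := by
  rw [← LinearMap.ker_eq_bot, LinearMap.ker_eq_bot']
  intro v hv
  refine Fock.ext_coeff fun S => ?_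
  rw [map_zero]
  induction hn : S.card using Nat.strong_induction_on generalizing S with
  | _ n ih =>
    subst hn
    have hproj : Fock.diag (fun T => if T.card < S.card then 0 else 1) v = v := by
      refine Fock.ext_coeff fun T => ?_
      rw [coeff_diag]
      split_ifs with h
      · rw [ih _ h T rfl, mul_zero]
      · rw [one_mul]
    set Θ : RatFun S.card := ∏ i : Fin S.card, ∏ j ∈ Finset.Ioi i,
      (ratVar i + ratVar j) / (ratVar i - ratVar j) with hΘ
    have hg := isGeneric_ratVar S.card
    have hΘ0 : Θ ≠ 0 := Finset.prod_ne_zero_iff.2 fun i _ => Finset.prod_ne_zero_iff.2 fun j hj =>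
      div_ne_zero (hg.add_ne i j) (hg.sub_ne i j (Finset.mem_Ioi.1 hj).ne)
    have h0 := symMap_eq_alternant S.card
      (algebraMap (MvPolynomial (Fin S.card) ℚ) (RatFun S.card)) hproj
    have h1 : alternant S.card v = 0 := by
      apply IsFractionRing.injective _ (RatFun S.card)
      rw [map_zero]
      have h3 := algebraMap_schurMap S.card v
      rw [hv, Pi.zero_apply, map_zero] at h3
      exact (mul_eq_zero.1 (h3.trans h0).symm).resolve_left hΘ0
    have h2 : (MvPolynomial.lcoeff ℚ
        (∑ i : Fin S.card, Finsupp.single i ((descList S).getD i 0 + 1))) ∘ₗ alternant S.card =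
        Fock.coeff S := Fock.hom_ext fun T => by
      rw [Fock.coeff_vec]
      exact coeff_alternant S T
    rw [← h2, LinearMap.comp_apply, h1, map_zero]

/-- By injectivity of `schurMap` the expansion chosen in `schurPCoeff` is the only one. -/
theorem psi_schurMap (v : Fock) : psi (schurMap v) = factorialMap v := by
  have hex : ∃ c : StrictPartition →₀ ℚ, schurMap v = c.sum fun lam a => a • schurP lam := by
    let E : Fock →ₗ[ℚ] (StrictPartition →₀ ℚ) := Fock.lift fun S => Finsupp.single (ofSet S) 1
    have hE : Finsupp.linearCombination ℚ schurP ∘ₗ E = schurMap := Fock.hom_ext fun S => by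
      simp [E, Fock.lift_vec, schurMap]
    exact ⟨E v, (LinearMap.congr_fun hE v).symm⟩
  have hcoeff : schurPCoeff (schurMap v) = hex.choose := by
    rw [schurPCoeff, dif_pos hex]
  have hspec := hex.choose_spec
  rw [psi, hcoeff]
  generalize hex.choose = c at hspec
  have h1 : schurMap (c.sum fun lam a => a • Fock.vec lam.toSet) = schurMap v := by
    rw [hspec, map_finsuppSum]
    simp [schurMap, Fock.lift_vec, ofSet_toSet]
  rw [← schurMap_injective h1, map_finsuppSum]
  simp [factorialMap, Fock.lift_vec, ofSet_toSet]

theorem frakP_eq {ρ : IntPartition} (hρ : ρ.IsOdd) :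
    frakP ρ = factorialMap (Fock.powerVec ρ.parts) := by
  rw [frakP, powerSumPartition_eq hρ, psi_schurMap]

end PolySeq

/-! ### Adding a box is multiplication by the first power sum. -/

namespace StrictPartition

/-- The number of elements of `S` that are at least `d`. -/
def numGE (S : Finset ℕ) (d : ℕ) : ℕ := (S.filter (d ≤ ·)).card

theorem numGE_succ (S : Finset ℕ) (d : ℕ) :
    numGE S d = numGE S (d + 1) + if d ∈ S then 1 else 0 := by
  have : S.filter (d ≤ ·) = S.filter (d + 1 ≤ ·) ∪ S.filter (· = d) := by
    ext k
    simp only [Finset.mem_filter, Finset.mem_union]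
    constructor
    · rintro ⟨h, h'⟩
      rcases h'.eq_or_lt with h'' | h''
      · exact Or.inr ⟨h, h''.symm⟩
      · exact Or.inl ⟨h, h''⟩
    · rintro (⟨h, h'⟩ | ⟨h, h'⟩)
      · exact ⟨h, by omega⟩
      · exact ⟨h, h'.ge⟩
  rw [numGE, numGE, this, Finset.card_union_of_disjoint, Finset.filter_eq']
  · split_ifs <;> simp
  · rw [Finset.disjoint_filter]
    intro k _ h h'
    omega

theorem numGE_insert {S : Finset ℕ} {k : ℕ} (hk : k ∉ S) (d : ℕ) :
    numGE (insert k S) d = numGE S d + if d ≤ k then 1 else 0 := by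
  rw [numGE, numGE, Finset.filter_insert]
  split_ifs with h
  · rw [Finset.card_insert_of_notMem (by simp [hk])]
  · simp

/-- Row i meets the diagonal j - i = d exactly when its part exceeds d; parts decrease, so the boxes
on that diagonal fill the rows 1, …, `numGE S d`. -/
theorem mem_shiftedDiagram_ofSet (S : Finset ℕ) (b : ℕ × ℕ) :
    b ∈ (ofSet S).1.shiftedDiagram ↔ 1 ≤ b.1 ∧ b.1 ≤ b.2 ∧ b.1 ≤ numGE S (b.2 - b.1) := by
  obtain ⟨i, j⟩ := b
  simp only [IntPartition.shiftedDiagram, Set.mem_ofPred_eq, length_ofSet]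
  by_cases hij : 1 ≤ i ∧ i ≤ j
  swap
  · tauto
  obtain ⟨h1, h2⟩ := hij
  set d := j - i with hd
  have hle : numGE S d ≤ S.card := Finset.card_filter_le _ _
  have hsplit : descList S = descList (S.filter (d ≤ ·)) ++ descList (S.filter (· < d)) := by
    refine descList_eq ?_ ?_
    · rw [List.pairwise_append]
      refine ⟨descList_pairwise _, descList_pairwise _, fun b hb c hc => ?_⟩
      rw [mem_descList, Finset.mem_filter] at hb hc
      exact hc.2.trans_le hb.2
    · ext b
      simp only [List.mem_toFinset, List.mem_append, mem_descList, Finset.mem_filter]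
      rcases le_or_gt d b with h | h <;> simp [h]
  have hlen : (descList (S.filter (d ≤ ·))).length = numGE S d := length_descList _
  have key : i ≤ S.card → (j < (ofSet S).1.part i + i ↔ i ≤ numGE S d) := by
    intro hi
    have hi' : i - 1 < (descList S).length := by rw [length_descList]; omega
    have e : (ofSet S).1.part i = (descList S)[i - 1] + 1 := by
      rw [IntPartition.part, parts_ofSet, List.getD_eq_getElem _ _ (by simpa using hi'),
        List.getElem_map]
    rw [e]
    constructor
    · intro h
      by_contra hlt
      have hm : (descList S)[i - 1] < d := by
        simp only [hsplit]
        rw [List.getElem_append_right (by omega)]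
        have := List.getElem_mem (l := descList (S.filter (· < d)))
          (n := i - 1 - (descList (S.filter (d ≤ ·))).length) (by
            have := congrArg List.length hsplit
            rw [List.length_append] at this
            omega)
        rw [mem_descList, Finset.mem_filter] at this
        exact this.2
      omega
    · intro h
      have hm : d ≤ (descList S)[i - 1] := by
        simp only [hsplit]
        rw [List.getElem_append_left (by omega)]
        have := List.getElem_mem (l := descList (S.filter (d ≤ ·))) (n := i - 1) (by omega)
        rw [mem_descList, Finset.mem_filter] at this
        exact this.2
      omega
  constructor
  · rintro ⟨_, h3, _, h4⟩
    exact ⟨h1, h2, (key h3).1 h4⟩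
  · rintro ⟨_, _, h3⟩
    exact ⟨h1, h3.trans hle, h2, (key (h3.trans hle)).2 h3⟩

theorem addsBox_iff_numGE (T S : Finset ℕ) : AddsBox (ofSet T) (ofSet S) ↔
    ∃ c, ∀ d, numGE S d = numGE T d + if d = c then 1 else 0 := by
  constructor
  · rintro ⟨b, hb, h⟩
    have hbS : b ∈ (ofSet S).1.shiftedDiagram := h ▸ Set.mem_insert _ _
    rw [mem_shiftedDiagram_ofSet] at hb hbS
    refine ⟨b.2 - b.1, fun d => ?_⟩
    have hmem : ∀ i, 1 ≤ i → (i ≤ numGE S d ↔ (i = b.1 ∧ d = b.2 - b.1) ∨ i ≤ numGE T d) := by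
      intro i hi
      have := Set.ext_iff.1 h (i, i + d)
      rw [Set.mem_insert_iff, mem_shiftedDiagram_ofSet, mem_shiftedDiagram_ofSet,
        Nat.add_sub_cancel_left, Prod.ext_iff] at this
      constructor
      · intro h3
        rcases this.1 ⟨hi, by omega, h3⟩ with h4 | h4
        · left
          dsimp only at h4
          omega
        · exact Or.inr h4.2.2
      · rintro (⟨h3, h4⟩ | h3)
        · refine (this.2 (Or.inl ⟨h3, ?_⟩)).2.2
          dsimp only
          omega
        · exact (this.2 (Or.inr ⟨hi, by omega, h3⟩)).2.2
    split_ifs with hd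
    · have : Finset.Icc 1 (numGE S d) = insert b.1 (Finset.Icc 1 (numGE T d)) := by
        ext i
        rw [Finset.mem_insert, Finset.mem_Icc, Finset.mem_Icc]
        constructor
        · rintro ⟨h3, h4⟩
          have := (hmem i h3).1 h4
          tauto
        · rintro (rfl | ⟨h3, h4⟩)
          · exact ⟨hbS.1, (hmem _ hbS.1).2 (Or.inl ⟨rfl, hd⟩)⟩
          · exact ⟨h3, (hmem i h3).2 (Or.inr h4)⟩
      have hc := congrArg Finset.card this
      rw [Finset.card_insert_of_notMem] at hc
      · simpa using hc
      · rw [Finset.mem_Icc]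
        rintro ⟨h3, h4⟩
        exact hb ⟨h3, hbS.2.1, hd ▸ h4⟩
    · have : Finset.Icc 1 (numGE S d) = Finset.Icc 1 (numGE T d) := by
        ext i
        rw [Finset.mem_Icc, Finset.mem_Icc]
        exact and_congr_right fun h3 => by rw [hmem i h3]; tauto
      simpa using congrArg Finset.card this
  · rintro ⟨c, hc⟩
    have hcc := hc c
    rw [if_pos rfl] at hcc
    -- The last box on the diagonal that has become longer.
    refine ⟨(numGE S c, numGE S c + c), ?_, ?_⟩
    · rw [mem_shiftedDiagram_ofSet]
      dsimp only
      rw [Nat.add_sub_cancel_left]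
      omega
    · ext ⟨i, j⟩
      rw [Set.mem_insert_iff, mem_shiftedDiagram_ofSet, mem_shiftedDiagram_ofSet, Prod.ext_iff, hc]
      dsimp only
      split_ifs with h <;> [subst h; skip] <;> omega

/-- Differences of consecutive diagonal lengths recover membership. Lengthening diagonal 0 creates a
part 1; lengthening diagonal k + 1 moves the element k to k + 1. -/
theorem addsBox_iff (T S : Finset ℕ) : AddsBox (ofSet T) (ofSet S) ↔
    (0 ∉ T ∧ S = insert 0 T) ∨ ∃ k ∈ T, k + 1 ∉ T ∧ S = insert (k + 1) (T.erase k) := by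
  rw [addsBox_iff_numGE]
  constructor
  · rintro ⟨c, hc⟩
    have hmem : ∀ d, (if d ∈ S then 1 else 0) + (if d + 1 = c then 1 else 0) =
        (if d ∈ T then 1 else 0) + if d = c then 1 else 0 := by
      intro d
      have h1 := hc d
      have h2 := hc (d + 1)
      have h3 := numGE_succ S d
      have h4 := numGE_succ T d
      omega
    rcases c with _ | k
    · left
      have h0 : 0 ∉ T := fun h => by
        have := hmem 0
        rw [if_pos h, if_pos (rfl : 0 = 0), if_neg (by omega : ¬ 0 + 1 = 0)] at this
        split_ifs at this
        all_goals omega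
      refine ⟨h0, ?_⟩
      ext d
      have := hmem d
      rw [Finset.mem_insert]
      rw [if_neg (by omega : ¬ d + 1 = 0)] at this
      split_ifs at this <;> simp_all
    · right
      have h1 := hmem (k + 1)
      have h2 := hmem k
      have hkT : k ∈ T := by
        by_contra h
        rw [if_neg h, if_pos (rfl : k + 1 = k + 1), if_neg (by omega : ¬ k = k + 1)] at h2
        omega
      have hkT' : k + 1 ∉ T := fun h => by
        rw [if_pos h, if_pos (rfl : k + 1 = k + 1), if_neg (by omega : ¬ k + 1 + 1 = k + 1)] at h1
        split_ifs at h1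
        all_goals omega
      refine ⟨k, hkT, hkT', ?_⟩
      ext d
      have := hmem d
      rw [Finset.mem_insert, Finset.mem_erase]
      by_cases h3 : d = k
      · subst h3
        simp_all
      · by_cases h4 : d = k + 1
        · subst h4
          simp_all
        · rw [if_neg (by omega : ¬ d + 1 = k + 1), if_neg h4] at this
          split_ifs at this <;> simp_all
  · rintro (⟨h0, rfl⟩ | ⟨k, hk, hk', rfl⟩)
    · refine ⟨0, fun d => ?_⟩
      rw [numGE_insert h0]
      simp
    · refine ⟨k + 1, fun d => ?_⟩
      have h1 := numGE_insert (Finset.notMem_erase k T) d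
      rw [Finset.insert_erase hk] at h1
      rw [numGE_insert fun h => hk' (Finset.mem_of_mem_erase h), h1]
      split_ifs <;> omega

/-- All signs cancel: no element lies strictly between k and k + 1, and creating 0 costs exactly the
parity of `T`. For r = 1 the quadratic sum in `mulP` is empty. -/
theorem mulP_one_vec (T : Finset ℕ) : Fock.mulP 1 (Fock.vec T) =
    (∑ k ∈ T, if k + 1 ∈ T then 0 else Fock.vec (insert (k + 1) (T.erase k))) +
      if 0 ∈ T then 0 else Fock.vec (insert 0 T) := by
  have h1 : Fock.mulP 1 (Fock.vec T) = (∑ k ∈ T, Fock.create (k + 1) (Fock.annih k (Fock.vec T))) +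
      Fock.create 0 (Fock.parity (Fock.vec T)) := by
    simp [Fock.mulP, Fock.shiftUp_vec (Finset.Subset.refl T), LinearMap.sum_apply]
  rw [h1]
  congr 1
  · refine Finset.sum_congr rfl fun k hk => ?_
    rw [Fock.annih_vec, if_pos hk, map_smul, Fock.create_vec]
    by_cases h : k + 1 ∈ T
    · rw [if_pos (Finset.mem_erase.2 ⟨by omega, h⟩), if_pos h, smul_zero]
    · rw [if_neg fun h' => h (Finset.mem_of_mem_erase h'), if_neg h, smul_smul,
        fockSign_erase hk, if_neg (by omega), one_mul]
      have : T.filter (k < ·) = T.filter (k + 1 < ·) := by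
        refine Finset.filter_congr fun a ha => ?_
        have : a ≠ k + 1 := fun e => h (e ▸ ha)
        omega
      have h2 : fockSign k T = fockSign (k + 1) T := by rw [fockSign, fockSign, this]
      rw [h2, fockSign_mul_self, one_smul]
  · rw [Fock.parity_vec, map_smul, Fock.create_vec]
    split_ifs with h
    · rw [smul_zero]
    · have : T.filter (0 < ·) = T := Finset.filter_true_of_mem fun a ha =>
        Nat.pos_of_ne_zero fun e => h (e ▸ ha)
      rw [smul_smul, fockSign, this, ← mul_pow]
      norm_num

open Classical in
theorem coeff_mulP_one_vec (S T : Finset ℕ) : Fock.coeff S (Fock.mulP 1 (Fock.vec T)) =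
    if AddsBox (ofSet T) (ofSet S) then 1 else 0 := by
  rw [mulP_one_vec, map_add, map_sum]
  have e1 : ∀ k ∈ T, Fock.coeff S
      (if k + 1 ∈ T then 0 else Fock.vec (insert (k + 1) (T.erase k))) =
      if k + 1 ∉ T ∧ insert (k + 1) (T.erase k) = S then 1 else 0 := by
    intro k _
    by_cases h : k + 1 ∈ T <;> simp [h, Fock.coeff_vec]
  have e2 : Fock.coeff S (if 0 ∈ T then 0 else Fock.vec (insert 0 T)) =
      if 0 ∉ T ∧ insert 0 T = S then 1 else 0 := by
    by_cases h : 0 ∈ T <;> simp [h, Fock.coeff_vec]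
  rw [Finset.sum_congr rfl e1, e2, addsBox_iff]
  by_cases h0 : 0 ∉ T ∧ insert 0 T = S
  · rw [if_pos h0, if_pos (Or.inl ⟨h0.1, h0.2.symm⟩), Finset.sum_eq_zero, zero_add]
    intro k hk
    refine if_neg fun h => ?_
    have h3 := congrArg Finset.card (h.2.trans h0.2.symm)
    rw [Finset.card_insert_of_notMem h0.1, Finset.card_insert_of_notMem fun h' =>
      h.1 (Finset.mem_of_mem_erase h'), Finset.card_erase_add_one hk] at h3
    omega
  · rw [if_neg h0, add_zero]
    split_ifs with h
    · obtain ⟨k, hk, hk', rfl⟩ := h.resolve_left fun h' => h0 ⟨h'.1, h'.2.symm⟩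
      rw [Finset.sum_eq_single_of_mem k hk, if_pos ⟨hk', rfl⟩]
      intro j hj hjk
      refine if_neg fun h' => ?_
      have h3 : j ∈ insert (k + 1) (T.erase k) :=
        Finset.mem_insert_of_mem (Finset.mem_erase.2 ⟨hjk, hj⟩)
      rw [← h'.2] at h3
      simp at h3
    · exact Finset.sum_eq_zero fun k hk => if_neg fun h' => h (Or.inr ⟨k, hk, h'.1, h'.2.symm⟩)

theorem AddsBox.size_eq {mu lam : StrictPartition} (h : AddsBox mu lam) :
    lam.1.size = mu.1.size + 1 := by
  rw [← ofSet_toSet mu, ← ofSet_toSet lam] at h ⊢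
  rw [size_ofSet, size_ofSet]
  rcases (addsBox_iff _ _).1 h with ⟨h0, h1⟩ | ⟨k, hk, hk', h1⟩
  · rw [h1, Finset.sum_insert h0, add_comm]
  · rw [h1, Finset.sum_insert fun h => hk' (Finset.mem_of_mem_erase h),
      ← Finset.add_sum_erase _ _ hk]
    omega

theorem finite_addsBox (lam : StrictPartition) : {mu | AddsBox mu lam}.Finite :=
  (finite_size_eq (lam.1.size - 1)).subset fun mu h => by
    have := AddsBox.size_eq h
    simp only [Set.mem_ofPred_eq]
    omega

theorem coeff_mulP_one (lam : StrictPartition) (v : Fock) :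
    Fock.coeff lam.toSet (Fock.mulP 1 v) =
      ∑ mu ∈ (finite_addsBox lam).toFinset, Fock.coeff mu.toSet v := by
  have : Fock.coeff lam.toSet ∘ₗ Fock.mulP 1 =
      ∑ mu ∈ (finite_addsBox lam).toFinset, Fock.coeff mu.toSet := by
    refine Fock.hom_ext fun T => ?_
    have e : ∀ mu : StrictPartition, T = mu.toSet ↔ mu = ofSet T := fun mu =>
      ⟨fun h => by rw [h, ofSet_toSet], fun h => by rw [h, toSet_ofSet]⟩
    rw [LinearMap.comp_apply, coeff_mulP_one_vec, LinearMap.sum_apply]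
    simp only [Fock.coeff_vec, e, Finset.sum_ite_eq']
    congr 1
    rw [ofSet_toSet]
    exact propext (Set.Finite.mem_toFinset (finite_addsBox lam)).symm
  simpa [LinearMap.sum_apply] using LinearMap.congr_fun this v

/-! ### Counting standard shifted tableaux. -/

/-- The chains of `n` steps from the empty partition to `lam`. -/
def IsChain (n : ℕ) (lam : StrictPartition) (T : Fin (n + 1) → StrictPartition) : Prop :=
  T 0 = empty ∧ T (Fin.last _) = lam ∧ ∀ i : Fin n, AddsBox (T i.castSucc) (T i.succ)

/-- A chain is determined by its last step and the chain before it. -/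
def chainEquiv (n : ℕ) (lam : StrictPartition) :
    {T // IsChain (n + 1) lam T} ≃ Σ mu : {mu // AddsBox mu lam}, {T // IsChain n mu.1 T} where
  toFun T := ⟨⟨T.1 (Fin.last n).castSucc, by
      have := T.2.2.2 (Fin.last n)
      rwa [Fin.succ_last, T.2.2.1] at this⟩,
    ⟨fun i => T.1 i.castSucc, T.2.1, rfl, fun i => T.2.2.2 i.castSucc⟩⟩
  invFun p := ⟨Fin.snoc p.2.1 lam, by
    refine ⟨?_, by simp, fun i => ?_⟩
    · have := Fin.snoc_castSucc (α := fun _ => StrictPartition) lam p.2.1 0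
      rw [Fin.castSucc_zero] at this
      rw [this, p.2.2.1]
    · refine Fin.lastCases ?_ (fun i => ?_) i
      · rw [Fin.snoc_castSucc, Fin.succ_last, Fin.snoc_last, p.2.2.2.1]
        exact p.1.2
      · rw [Fin.snoc_castSucc, ← Fin.castSucc_succ, Fin.snoc_castSucc]
        exact p.2.2.2.2 i⟩
  left_inv T := by
    refine Subtype.ext (funext fun i => ?_)
    refine Fin.lastCases ?_ (fun i => ?_) i
    · simp [T.2.2.1]
    · simp
  right_inv p := by
    obtain ⟨⟨mu, hmu⟩, ⟨T, hT⟩⟩ := p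
    have h : (fun i : Fin (n + 1) =>
        (Fin.snoc T lam : Fin (n + 2) → StrictPartition) i.castSucc) = T := by simp
    have hl : (Fin.snoc T lam : Fin (n + 2) → StrictPartition) (Fin.last n).castSucc = mu := by
      rw [Fin.snoc_castSucc]
      exact hT.2.1
    refine Sigma.ext (Subtype.ext hl) ?_
    rw [Subtype.heq_iff_coe_eq fun x => iff_of_eq (congrArg (fun m => IsChain n m x) hl)]
    exact h

/-- Removing the last step gives the same recursion as the coefficients of p_1^n. Finiteness is
carried along because `Nat.card` of an infinite type would be 0. -/
theorem card_isChain (n : ℕ) (lam : StrictPartition) : Finite {T // IsChain n lam T} ∧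
    (Nat.card {T // IsChain n lam T} : ℚ) =
      Fock.coeff lam.toSet (Fock.powerVec (List.replicate n 1)) := by
  induction n generalizing lam with
  | zero =>
    have hs : Subsingleton {T // IsChain 0 lam T} := ⟨fun T T' => Subtype.ext (funext fun i => by
      rw [show i = 0 from Fin.ext (by omega), T.2.1, T'.2.1])⟩
    refine ⟨inferInstance, ?_⟩
    have he : toSet empty = ∅ := rfl
    rw [List.replicate_zero, Fock.powerVec, Fock.vac, Fock.coeff_vec]
    by_cases h : lam = empty
    · have : Nonempty {T // IsChain 0 lam T} :=
        ⟨fun _ => empty, rfl, h.symm, fun i => i.elim0⟩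
      have hu : Nat.card {T // IsChain 0 lam T} = 1 := Nat.card_eq_one_iff_unique.2 ⟨hs, this⟩
      rw [hu, if_pos (by rw [h, he]), Nat.cast_one]
    · have : IsEmpty {T // IsChain 0 lam T} := ⟨fun T => h (T.2.2.1.symm.trans T.2.1)⟩
      rw [Nat.card_of_isEmpty, if_neg, Nat.cast_zero]
      intro h'
      apply h
      rw [← ofSet_toSet lam, ← h', ← he, ofSet_toSet]
  | succ n ih =>
    have : Fintype {mu // AddsBox mu lam} := (finite_addsBox lam).fintype
    have hfin : ∀ mu : {mu // AddsBox mu lam}, Finite {T // IsChain n mu.1 T} := fun mu =>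
      (ih mu.1).1
    refine ⟨Finite.of_equiv _ (chainEquiv n lam).symm, ?_⟩
    rw [Nat.card_congr (chainEquiv n lam), Nat.card_sigma, List.replicate_succ, Fock.powerVec,
      coeff_mulP_one, Nat.cast_sum]
    rw [Finset.sum_congr rfl fun mu _ => (ih mu.1).2]
    exact (Finset.sum_subtype (finite_addsBox lam).toFinset (fun mu => by simp)
      fun mu => Fock.coeff mu.toSet (Fock.powerVec (List.replicate n 1))).symm

theorem g_eq_coeff (lam : StrictPartition) :
    (lam.g : ℚ) = Fock.coeff lam.toSet (Fock.powerVec (List.replicate lam.1.size 1)) :=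
  (card_isChain lam.1.size lam).2

end StrictPartition

/-! ### Values of factorial Schur P-functions at strict partitions. -/

namespace StrictPartition

open Polynomial PolySeq

/-- The parts of a strict partition as a point with as many coordinates as there are parts. -/
def point (lam : StrictPartition) (i : Fin lam.1.length) : ℕ := lam.1.part (i + 1)

theorem point_eq (lam : StrictPartition) (i : Fin lam.1.length) :
    lam.point i = lam.1.parts[(i : ℕ)]'i.2 := by
  rw [point, IntPartition.part, Nat.add_sub_cancel]
  exact List.getD_eq_getElem _ _ i.2

theorem map_point (lam : StrictPartition) :
    (Finset.univ : Finset (Fin lam.1.length)).val.map lam.point = (lam.1.parts : Multiset ℕ) := by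
  rw [Fin.univ_val_map]
  exact congrArg _ (List.ext_getElem (by rw [List.length_ofFn]; rfl) fun i h1 h2 => by
    rw [List.getElem_ofFn]; exact lam.point_eq _)

theorem point_pos (lam : StrictPartition) (i : Fin lam.1.length) : 0 < lam.point i := by
  rw [point_eq]
  exact lam.1.pos _ (List.getElem_mem _)

theorem isGeneric_point (lam : StrictPartition) : IsGeneric fun i => (lam.point i : ℚ) := by
  constructor
  · intro i j hij h
    have h1 : lam.point i = lam.point j := by exact_mod_cast sub_eq_zero.1 h
    rw [point_eq, point_eq] at h1
    exact hij (Fin.ext ((lam.2.getElem_inj_iff).1 h1))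
  · intro i j
    have h1 := lam.point_pos i
    have h2 := lam.point_pos j
    positivity

theorem sum_point (lam : StrictPartition) : ∑ i, lam.point i = lam.1.size := by
  rw [IntPartition.size, ← Multiset.sum_coe, ← map_point]
  rfl

/-- The values of the factorial Schur `P`-functions at a strict partition. -/
noncomputable def evalAt (lam : StrictPartition) : Fock →ₗ[ℚ] ℚ :=
  symMap (fun i => (lam.point i : ℚ)) fallingPoly Finset.univ

theorem value_factorialMap (lam : StrictPartition) (v : Fock) :
    (factorialMap v).value lam = lam.evalAt v := by
  refine Fock.map_eq_of_vec (MvPolynomial.eval fun i : Fin lam.1.length => (lam.1.part (i + 1) : ℚ))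
    (LinearMap.proj lam.1.length ∘ₗ factorialMap) lam.evalAt (fun S => ?_) v
  rw [evalAt, symMap_vec]
  simp only [LinearMap.comp_apply, LinearMap.proj_apply, factorialMap, Fock.lift_vec,
    factorialSchurP_ofSet]
  refine eval_toPolynomial_symSum _ (fun u hu => ?_) lam.isGeneric_point
  obtain ⟨k, _, rfl⟩ := List.mem_map.1 hu
  rw [fallingPoly, eval_prod]
  exact Finset.prod_eq_zero (Finset.mem_range.2 (Nat.succ_pos k)) (by simp)

/-- From X · `fallingPoly k` = `fallingPoly (k + 1)` + (k + 1) · `fallingPoly k`: the weight k + 1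
is the part itself, so `weightOp` is `sizeOp`, while p_1 takes the value |λ|. -/
theorem evalAt_mulP_one (lam : StrictPartition) (v : Fock) :
    lam.evalAt (Fock.mulP 1 v) = (lam.1.size : ℚ) * lam.evalAt v - lam.evalAt (Fock.sizeOp v) := by
  have h := symMap_mulP lam.isGeneric_point (u := fallingPoly) odd_one
    (fun k hk => by
      obtain rfl : k = 0 := by omega
      simp [fallingPoly]) (c := fun k => (k : ℚ) + 1)
    (fun k => by
      rw [fallingPoly, fallingPoly, Finset.prod_range_succ _ (k + 1)]
      push_cast
      simp only [map_add, map_natCast, map_one]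
      ring) Finset.univ v
  simp only [pow_one] at h
  rw [map_add, ← Nat.cast_sum, sum_point] at h
  rw [evalAt, h, Fock.sizeOp]
  ring

/-- In a nonzero term every falling power forces its variable to be at least the corresponding part;
the bound on the total then forces equality throughout. -/
theorem symSum_fallingPoly_ne_zero {ι : Type} [DecidableEq ι] (y : ι → ℕ) (hy : ∀ i, 0 < y i)
    (l : List ℕ) (s : Finset ι) (hs : ∑ i ∈ s, y i ≤ (l.map (· + 1)).sum)
    (h : symSum (fun i => (y i : ℚ)) (l.map fallingPoly) s ≠ 0) :
    s.val.map y = ((l.map (· + 1) : List ℕ) : Multiset ℕ) := by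
  induction l generalizing s with
  | nil =>
    have hs0 : s = ∅ := by
      by_contra hne
      obtain ⟨i, hi⟩ := Finset.nonempty_iff_ne_empty.2 hne
      have := Finset.single_le_sum (f := y) (fun _ _ => Nat.zero_le _) hi
      have := hy i
      simp at hs
      have := hs i hi
      omega
    subst hs0
    rfl
  | cons a l ih =>
    rw [List.map_cons, symSum_cons] at h
    obtain ⟨i, hi, hne⟩ := Finset.exists_ne_zero_of_sum_ne_zero h
    have h1 := left_ne_zero_of_mul (left_ne_zero_of_mul hne)
    have h2 := right_ne_zero_of_mul hne
    have ha : a + 1 ≤ y i := by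
      by_contra hlt
      apply h1
      rw [fallingPoly, map_prod]
      exact Finset.prod_eq_zero (Finset.mem_range.2 (by omega : y i < a + 1)) (by simp)
    have h3 := Finset.add_sum_erase s y hi
    rw [List.map_cons, List.sum_cons] at hs
    have h4 := ih (s.erase i) (by omega) h2
    have h5 : ∑ j ∈ s.erase i, y j = (l.map (· + 1)).sum := by
      rw [Finset.sum, h4, Multiset.sum_coe]
    have h6 : y i = a + 1 := by omega
    rw [← Finset.insert_erase hi, Finset.insert_val_of_notMem (Finset.notMem_erase i s),
      Multiset.map_cons, h4, h6, List.map_cons, Multiset.cons_coe]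

theorem evalAt_vec_eq_zero (lam : StrictPartition) {S : Finset ℕ}
    (hS : lam.1.size ≤ ∑ k ∈ S, (k + 1)) (hne : S ≠ lam.toSet) : lam.evalAt (Fock.vec S) = 0 := by
  by_contra h
  rw [evalAt, symMap_vec] at h
  have := symSum_fallingPoly_ne_zero lam.point lam.point_pos (descList S) Finset.univ
    (by rw [sum_map_descList, sum_point]; exact hS) h
  rw [map_point, Multiset.coe_eq_coe] at this
  apply hne
  rw [← toSet_ofSet S]
  congr 1
  exact Subtype.ext (IntPartition.ext (this.eq_of_pairwise' lam.1.sorted (ofSet S).1.sorted).symm)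

/-- The value of the factorial Schur `P`-function of a strict partition at this partition. -/
noncomputable def selfValue (lam : StrictPartition) : ℚ := lam.evalAt (Fock.vec lam.toSet)

/-- Writing homogeneity as invariance under a projection reduces statements about homogeneous
vectors to basis vectors. -/
theorem diag_eq_self {d : ℕ} {v : Fock} (hv : Fock.sizeOp v = (d : ℚ) • v) :
    Fock.diag (fun S => if ∑ k ∈ S, (k + 1) = d then 1 else 0) v = v := by
  refine Fock.ext_coeff fun S => ?_
  have h := congrArg (Fock.coeff S) hv
  rw [Fock.coeff_sizeOp, map_smul, smul_eq_mul] at h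
  rw [coeff_diag]
  split_ifs with hS
  · rw [one_mul]
  · rw [zero_mul]
    by_contra h0
    have := mul_right_cancel₀ (Ne.symm h0) h
    exact hS (by exact_mod_cast this)

theorem evalAt_of_size_eq (lam : StrictPartition) {v : Fock}
    (hv : Fock.sizeOp v = (lam.1.size : ℚ) • v) :
    lam.evalAt v = Fock.coeff lam.toSet v * lam.selfValue := by
  have : lam.evalAt ∘ₗ Fock.diag (fun S => if ∑ k ∈ S, (k + 1) = lam.1.size then 1 else 0) =
      lam.selfValue • Fock.coeff lam.toSet ∘ₗ
        Fock.diag (fun S => if ∑ k ∈ S, (k + 1) = lam.1.size then 1 else 0) := by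
    refine Fock.hom_ext fun S => ?_
    simp only [LinearMap.comp_apply, LinearMap.smul_apply, Fock.diag_vec, map_smul, Fock.coeff_vec]
    split_ifs with h1 h2 h2
    · rw [h2, selfValue]
      simp
    · rw [evalAt_vec_eq_zero lam h1.ge h2]
      simp
    all_goals simp
  have h := LinearMap.congr_fun this v
  simp only [LinearMap.comp_apply, LinearMap.smul_apply, diag_eq_self hv, smul_eq_mul] at h
  rw [h, mul_comm]

theorem evalAt_of_size_lt (lam : StrictPartition) {v : Fock} {d : ℕ} (hd : lam.1.size < d)
    (hv : Fock.sizeOp v = (d : ℚ) • v) : lam.evalAt v = 0 := by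
  have : lam.evalAt ∘ₗ Fock.diag (fun S => if ∑ k ∈ S, (k + 1) = d then 1 else 0) = 0 := by
    refine Fock.hom_ext fun S => ?_
    simp only [LinearMap.comp_apply, Fock.diag_vec, map_smul, LinearMap.zero_apply]
    split_ifs with h1
    · rw [evalAt_vec_eq_zero lam (by omega), smul_zero]
      rintro rfl
      rw [← size_ofSet, ofSet_toSet] at h1
      omega
    · rw [zero_smul]
  have h := LinearMap.congr_fun this v
  rwa [LinearMap.comp_apply, diag_eq_self hv] at h

theorem odd_of_mem_replicate_append {l : List ℕ} (hl : ∀ r ∈ l, Odd r) (m : ℕ) :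
    ∀ r ∈ List.replicate m 1 ++ l, Odd r := by
  intro r hr
  rcases List.mem_append.1 hr with h | h
  · rw [List.eq_of_mem_replicate h]
    exact odd_one
  · exact hl r h

theorem sizeOp_powerVec_replicate {l : List ℕ} (hl : ∀ r ∈ l, Odd r) (m : ℕ) :
    Fock.sizeOp (Fock.powerVec (List.replicate m 1 ++ l)) =
      ((m + l.sum : ℕ) : ℚ) • Fock.powerVec (List.replicate m 1 ++ l) := by
  rw [Fock.sizeOp_powerVec (odd_of_mem_replicate_append hl m), List.sum_append,
    List.sum_replicate, smul_eq_mul, mul_one]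

/-- On degree d a factor p_1 multiplies the value at λ by |λ| - d. After m factors the product of
these numbers is m!, the degree has reached |λ|, and only the coordinate at λ survives. -/
theorem evalAt_powerVec (lam : StrictPartition) {l : List ℕ} (hl : ∀ r ∈ l, Odd r) {m : ℕ}
    (hm : m + l.sum = lam.1.size) : (m.factorial : ℚ) * lam.evalAt (Fock.powerVec l) =
      Fock.coeff lam.toSet (Fock.powerVec (List.replicate m 1 ++ l)) * lam.selfValue := by
  have key : ∀ j ≤ m, (m.descFactorial j : ℚ) * lam.evalAt (Fock.powerVec l) =
      lam.evalAt (Fock.powerVec (List.replicate j 1 ++ l)) := by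
    intro j hj
    induction j with
    | zero => simp
    | succ j ih =>
      rw [List.replicate_succ, List.cons_append, Fock.powerVec, evalAt_mulP_one,
        sizeOp_powerVec_replicate hl, map_smul, smul_eq_mul, ← sub_mul, ← ih (by omega), ← hm,
        Nat.descFactorial_succ]
      push_cast [Nat.cast_sub (by omega : j ≤ m)]
      ring
  rw [← Nat.descFactorial_self, key m le_rfl, evalAt_of_size_eq]
  rw [sizeOp_powerVec_replicate hl, hm]

/-- The case of the constant function 1. -/
theorem g_mul_selfValue (lam : StrictPartition) :
    (lam.g : ℚ) * lam.selfValue = lam.1.size.factorial := by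
  have h := evalAt_powerVec lam (l := []) (by simp) (m := lam.1.size) (by simp)
  rw [List.append_nil, ← g_eq_coeff] at h
  rw [← h, Fock.powerVec, evalAt, symMap_vac, mul_one]

theorem mem_ofSize {n : ℕ} {lam : StrictPartition} : lam ∈ ofSize n ↔ lam.1.size = n :=
  (finite_size_eq n).mem_toFinset

theorem form_eq_sum_ofSize {n : ℕ} {v : Fock} (hv : Fock.sizeOp v = (n : ℚ) • v) (w : Fock) :
    Fock.form v w = ∑ lam ∈ ofSize n,
      2⁻¹ ^ lam.1.length * (Fock.coeff lam.toSet v * Fock.coeff lam.toSet w) := by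
  have h : v = ∑ lam ∈ ofSize n, Fock.coeff lam.toSet v • Fock.vec lam.toSet := by
    refine Fock.ext_coeff fun S => ?_
    rw [map_sum]
    simp only [map_smul, Fock.coeff_vec]
    have e : ∀ mu : StrictPartition, mu.toSet = S ↔ mu = ofSet S := fun mu =>
      ⟨fun h => by rw [← h, ofSet_toSet], fun h => by rw [h, toSet_ofSet]⟩
    simp only [e, smul_eq_mul, mul_ite, mul_one, mul_zero, Finset.sum_ite_eq', toSet_ofSet]
    split_ifs with hS
    · rfl
    · rw [← diag_eq_self hv, coeff_diag, if_neg, zero_mul]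
      rwa [mem_ofSize, size_ofSet] at hS
  conv_lhs => rw [h]
  rw [map_sum, LinearMap.sum_apply]
  refine Finset.sum_congr rfl fun lam _ => ?_
  rw [map_smul, LinearMap.smul_apply, Fock.form_vec, smul_eq_mul, ← length_ofSet, ofSet_toSet]
  ring

theorem length_le_size (ρ : IntPartition) : ρ.length ≤ ρ.size := by
  have := List.card_nsmul_le_sum ρ.parts 1 fun a ha => ρ.pos a ha
  simpa [IntPartition.length, IntPartition.size] using this

end StrictPartition

/-! ### The averages. -/

open StrictPartition in
theorem average_frakP_mul_frakP {ρ σ : IntPartition} (hρ : ρ.IsOdd) (hσ : σ.IsOdd) {n : ℕ}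
    (hρn : ρ.size ≤ n) (hσn : σ.size ≤ n) :
    StrictPartition.average n (PolySeq.frakP ρ * PolySeq.frakP σ).value =
      n.factorial * 2 ^ n / ((n - ρ.size).factorial * (n - σ.size).factorial) *
        Fock.form (Fock.powerVec (List.replicate (n - ρ.size) 1 ++ ρ.parts))
          (Fock.powerVec (List.replicate (n - σ.size) 1 ++ σ.parts)) := by
  have hs := sizeOp_powerVec_replicate hρ (n - ρ.size)
  rw [show n - ρ.size + ρ.parts.sum = n from Nat.sub_add_cancel hρn] at hs
  rw [form_eq_sum_ofSize hs, average, Finset.mul_sum]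
  refine Finset.sum_congr rfl fun lam hlam => ?_
  have hn : lam.1.size = n := mem_ofSize.1 hlam
  have hval : (PolySeq.frakP ρ * PolySeq.frakP σ).value lam =
      lam.evalAt (Fock.powerVec ρ.parts) * lam.evalAt (Fock.powerVec σ.parts) := by
    rw [← value_factorialMap, ← value_factorialMap, ← PolySeq.frakP_eq hρ, ← PolySeq.frakP_eq hσ]
    exact map_mul _ _ _
  have h1 := evalAt_powerVec lam hρ (m := n - ρ.size)
    (by rw [hn]; exact Nat.sub_add_cancel hρn)
  have h2 := evalAt_powerVec lam hσ (m := n - σ.size)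
    (by rw [hn]; exact Nat.sub_add_cancel hσn)
  have h3 := g_mul_selfValue lam
  have hf : ∀ m : ℕ, (m.factorial : ℚ) ≠ 0 := fun m => Nat.cast_ne_zero.2 m.factorial_ne_zero
  have hl : (2 : ℚ) ^ (n - lam.1.length) = 2 ^ n * 2⁻¹ ^ lam.1.length := by
    rw [inv_pow, pow_sub₀ _ two_ne_zero (hn ▸ length_le_size lam.1)]
  rw [hval, plancherel, hl]
  rw [hn] at h3
  rw [mul_comm, ← eq_div_iff (hf _)] at h1 h2
  rw [h1, h2]
  have := hf n
  have := hf (n - ρ.size)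
  have := hf (n - σ.size)
  generalize Fock.coeff lam.toSet (Fock.powerVec (List.replicate (n - ρ.size) 1 ++ ρ.parts)) = A
  generalize Fock.coeff lam.toSet (Fock.powerVec (List.replicate (n - σ.size) 1 ++ σ.parts)) = B
  field_simp
  rw [← h3]
  ring

/-- As neither partition contains 1, deleting the ones from the padded list recovers it. -/
theorem replicate_append_perm_iff {ρ σ : IntPartition} (hρ1 : ρ.mult 1 = 0) (hσ1 : σ.mult 1 = 0)
    {n : ℕ} :
    (List.replicate (n - ρ.size) 1 ++ ρ.parts).Perm (List.replicate (n - σ.size) 1 ++ σ.parts) ↔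
      ρ = σ := by
  constructor
  · intro h
    have : ρ.parts.Perm σ.parts := by
      refine List.perm_iff_count.2 fun a => ?_
      by_cases ha : a = 1
      · subst ha
        exact hρ1.trans hσ1.symm
      · have := h.count_eq a
        simpa [List.count_append, List.count_replicate, Ne.symm ha] using this
    exact IntPartition.ext (this.eq_of_pairwise' ρ.sorted σ.sorted)
  · rintro rfl
    exact List.Perm.refl _

theorem listZ_replicate_append {l : List ℕ} (hl : l.count 1 = 0) (m : ℕ) :
    Fock.listZ (List.replicate m 1 ++ l) = m.factorial * Fock.listZ l := by
  induction m with
  | zero => simp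
  | succ m ih =>
    rw [List.replicate_succ, List.cons_append, Fock.listZ_cons, ih, List.count_append, hl,
      List.count_replicate_self, Nat.factorial_succ]
    ring

-- 𝔭_ρ combines the P*_μ with |μ| = |ρ|, all of which vanish at partitions of smaller size.
open StrictPartition in
theorem average_eq_zero_of_lt {ρ σ : IntPartition} (hρ : ρ.IsOdd) {n : ℕ} (hρn : n < ρ.size) :
    StrictPartition.average n (PolySeq.frakP ρ * PolySeq.frakP σ).value = 0 := by
  refine Finset.sum_eq_zero fun lam hlam => ?_
  have hval : (PolySeq.frakP ρ * PolySeq.frakP σ).value lam =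
      (PolySeq.frakP ρ).value lam * (PolySeq.frakP σ).value lam := map_mul _ _ _
  have h0 : lam.evalAt (Fock.powerVec ρ.parts) = 0 :=
    evalAt_of_size_lt lam (d := ρ.parts.sum) (by rwa [mem_ofSize.1 hlam])
      (Fock.sizeOp_powerVec hρ)
  rw [hval, PolySeq.frakP_eq hρ, value_factorialMap, h0, zero_mul, mul_zero]

theorem theorem4p4 (ρ σ : IntPartition) (hρ : ρ.IsOdd) (hσ : σ.IsOdd)
    (hρ1 : ρ.mult 1 = 0) (hσ1 : σ.mult 1 = 0) (n : ℕ) :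
    StrictPartition.average n (PolySeq.frakP ρ * PolySeq.frakP σ).value =
      if ρ = σ then
        (2 : ℚ) ^ (ρ.size - ρ.length) * (ρ.z : ℚ) * (n.descFactorial ρ.size : ℚ)
      else 0 := by
  by_cases hρn : ρ.size ≤ n
  swap
  · rw [average_eq_zero_of_lt hρ (not_le.1 hρn),
      Nat.descFactorial_eq_zero_iff_lt.2 (not_le.1 hρn)]
    simp
  by_cases hσn : σ.size ≤ n
  swap
  · rw [mul_comm, average_eq_zero_of_lt hσ (not_le.1 hσn), if_neg]
    rintro rfl
    exact hσn hρn
  rw [average_frakP_mul_frakP hρ hσ hρn hσn,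
    Fock.form_powerVec (StrictPartition.odd_of_mem_replicate_append hρ _)
      (StrictPartition.odd_of_mem_replicate_append hσ _)]
  simp only [replicate_append_perm_iff hρ1 hσ1]
  split_ifs with h
  swap
  · rw [mul_zero]
  subst h
  have hz : Fock.listZ ρ.parts = ρ.z := rfl
  have hd := Nat.factorial_mul_descFactorial hρn
  have hl := StrictPartition.length_le_size ρ
  have hlen : (List.replicate (n - ρ.size) 1 ++ ρ.parts).length = n - ρ.size + ρ.length := by
    rw [List.length_append, List.length_replicate, IntPartition.length]
  -- The second factor cancels 2^ℓ of the padded partition, whose length is n - |ρ| + ℓ(ρ).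
  have hpow : (2 : ℚ) ^ n = 2 ^ (ρ.size - ρ.length) * 2 ^ (n - ρ.size + ρ.length) := by
    rw [← pow_add]
    congr 1
    omega
  rw [listZ_replicate_append hρ1, hz, hlen, ← hd, hpow]
  have hf : ((n - ρ.size).factorial : ℚ) ≠ 0 := Nat.cast_ne_zero.2 (Nat.factorial_ne_zero _)
  push_cast
  field_simp
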